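/- **Setting.** Let $n\ge 2$, $m\ge 1$ be integers and $p$ a prime. Let $\mathbb H_n$ be the set of complex symmetric $n\times n$ matrices with positive definite imaginary part, $\mathbb H_{n,m}=\mathbb H_n\times\mathbb C^{(m,n)}$, $J_n=\begin{pmatrix}0&I_n\\-I_n&0\end{pmatrix}$, $\Gamma_n=Sp(n,\mathbb Z)$, $O_n(\ell)=\{M\in\mathbb Z^{(2n,2n)}\mid {}^tMJ_nM=\ell J_n\}$ and $O_{n,p}=\bigcup_{l\ge0}O_n(p^l)$. Let $\sigma$ denote the trace. Let $\mathcal M$ be a real symmetric, half-integral, positive semi-definite $m\times m$ matrix. *Slash action.* Let $\rho:GL(n,\mathbb C)\to GL(V_\rho)$ be a rational representation on a finite dimensional complex vector space. For $g=\begin{pmatrix}A&B\\C&D\end{pmatrix}\in O_n(\ell)$, integral $\lambda,\mu\in\mathbb Z^{(m,n)}$, $\kappa\in\mathbb Z^{(m,m)}$ and $f:\mathbb H_{n,m}\to V_\rho$ put, with $W=Z+\lambda\Omega+\mu$, $$\big(f|_{\rho,\mathcal M}[(g,(\lambda,\mu;\kappa))]\big)(\Omega,Z)=e^{-2\pi i\ell\,\sigma(\mathcal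 M W(C\Omega+D)^{-1}C\,{}^tW)}\,e^{2\pi i\ell\,\sigma(\mathcal M(\lambda\Omega\,{}^t\lambda+2\lambda\,{}^tZ+\kappa+\mu\,{}^t\lambda))}\,\rho(C\Omega+D)^{-1}f\big((A\Omega+B)(C\Omega+D)^{-1},\ \ell\,W(C\Omega+D)^{-1}\big).$$ For $\ell=1$ this is the usual action of the Jacobi group. *Jacobi forms.* $J_{\rho,\mathcal M}(\Gamma_n)$ is the space of holomorphic $f:\mathbb H_{n,m}\to V_\rho$ such that (A) $f|_{\rho,\mathcal M}[(\gamma,(\lambda,\mu;\kappa))]=f$ for all $\gamma\in\Gamma_n$ and all integral $\lambda,\mu,\kappa$ with $\kappa+\mu\,{}^t\lambda$ symmetric, and (B) for some nonzero integer $\lambda_\Gamma$ and every $\gamma\in\Gamma_n$, $f|_{\rho,\mathcal M}[(\gamma,(0,0;0))]$ has a Fourier expansion $\sum_{T,R}c(T,R)\,e^{\frac{2\pi i}{\lambda_\Gamma}\sigma(T\Omega)}e^{2\pi i\sigma(RZ)}$ over half-integral $T={}^tT\ge0$ and $R\in\mathbb Z^{(n,m)}$, with $c(T,R)\neq0$ only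 if $\begin{pmatrix}\frac1{\lambda_\Gamma}T&\frac12R\\\frac12{}^tR&\mathcal M\end{pmatrix}\ge0$. *Hecke operators.* Let $\check{\mathscr L}_{n,p}$ and $\check{\mathscr H}_{n,p}$ be the $\mathbb C$-modules freely generated by the left cosets $\Gamma_nM$ and by the double cosets $\Gamma_nM\Gamma_n$, $M\in O_{n,p}$, and let $j:\check{\mathscr H}_{n,p}\to\check{\mathscr L}_{n,p}$ be the injective linear map sending a double coset to the (finite) sum of the left cosets of which it is the disjoint union. Put $f|\Gamma_nM=f|_{\rho,\mathcal M}[(M,(0,0;0))]$, extend linearly to $\check{\mathscr L}_{n,p}$, and put $f|T=f|j(T)$ for $T\in\check{\mathscr H}_{n,p}$. *Zharkovskaya map.* Fix $r\in\mathbb Z$. Every left coset in $O_{n,p}$ has a representative $M=\begin{pmatrix}A&B\\0&D\end{pmatrix}$ with $$A=\begin{pmatrix}a&{}^t\alpha\\0&A^*\end{pmatrix},\quad B=\begin{pmatrix}b&{}^t\beta_1\\\beta_2&B^*\end{pmatrix},\quad D=\begin{pmatrix}d&0\\\delta&D^*\end{pmatrix},\quad d>0.$$ Put $M^*=\begin{pmatrix}A^*&B^*\\0&D^*\end{pmatrix}\in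 O_{n-1,p}$ and $(\Gamma_nM)^*=d^{-r}\,\Gamma_{n-1}M^*$, and extend linearly to $\check{\mathscr L}_{n,p}\to\check{\mathscr L}_{n-1,p}$. For $T\in\check{\mathscr H}_{n,p}$, the element $T^*\in\check{\mathscr H}_{n-1,p}$ (with parameter $r$) is the one with $j(T^*)=j(T)^*$. *Modified Siegel–Jacobi operator.* For $(\Omega,Z)\in\mathbb H_{n-1,m}$, $$(\Psi^0_{n,n-1}f)(\Omega,Z)=\lim_{t\to\infty}f\left(\begin{pmatrix}it&0\\0&\Omega\end{pmatrix},(0,Z)\right).$$ **Theorem 9.4.** Let $\rho:GL(n,\mathbb C)\to GL(V_\rho)$ and $\rho_0:GL(n-1,\mathbb C)\to GL(V_{\rho_0})$ be rational finite dimensional representations, $R:V_\rho\to V_{\rho_0}$ a linear map and $k\in\mathbb Z$ such that 1. $R\circ\rho\begin{pmatrix}1&0\\0&A\end{pmatrix}=\rho_0(A)\circ R$ for all $A\in GL(n-1,\mathbb C)$; 2. $R\circ\rho\begin{pmatrix}a&0\\0&I_{n-1}\end{pmatrix}=a^kR$ for all $a\in\mathbb C^\times$. Then for all $f\in J_{\rho,\mathcal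 M}(\Gamma_n)$ and $T\in\check{\mathscr H}_{n,p}$, the element $T^*\in\check{\mathscr H}_{n-1,p}$ with parameter $r=k$ exists, the limits defining $\Psi^0_{n,n-1}f$ and $\Psi^0_{n,n-1}(f|T)$ exist on $\mathbb H_{n-1,m}$, and $$(R\circ\Psi^0_{n,n-1})(f|T)=\big(R\circ\Psi^0_{n,n-1}f\big)\big|T^*\qquad\text{on }\mathbb H_{n-1,m},$$ where on the right $T^*$ acts through $\rho_0$ and $\mathcal M$. -/

import Mathlib

open scoped Matrix Topology

noncomputable section

namespace SiegelJacobi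

open Matrix Filter

/-! ### The Siegel upper half plane, rational representations -/

/-- The Siegel upper half plane `ℍₙ`: complex symmetric matrices with positive definite
imaginary part. -/
def siegelH (n : ℕ) : Set (Matrix (Fin n) (Fin n) ℂ) :=
  {Ω | Ω.IsSymm ∧ (Ω.map Complex.im).PosDef}

/-- A representation of `GL(n, ℂ)` is rational if its matrix coefficients are regular functions on
`GL(n, ℂ)`, i.e. polynomials in the matrix entries divided by a power of the determinant. -/
def IsRationalRep {n : ℕ} {V : Type*} [AddCommGroup V] [Module ℂ V]
    (ρ : Representation ℂ (GeneralLinearGroup (Fin n) ℂ) V) : Prop :=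
  ∀ (v : V) (φ : Module.Dual ℂ V), ∃ (P : MvPolynomial (Fin n × Fin n) ℂ) (s : ℕ),
    ∀ g : GeneralLinearGroup (Fin n) ℂ,
      φ (ρ g v) * (g : Matrix (Fin n) (Fin n) ℂ).det ^ s
        = MvPolynomial.eval (fun ij => (g : Matrix (Fin n) (Fin n) ℂ) ij.1 ij.2) P

open Classical in
/-- `ρ(X)⁻¹ v` for an invertible matrix `X`. (It is only used for `X = CΩ + D`, which is
invertible for `Ω ∈ ℍₙ`; the value for singular `X` plays no role.) -/
def repInv {n : ℕ} {V : Type*} [AddCommGroup V] [Module ℂ V]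
    (ρ : Representation ℂ (GeneralLinearGroup (Fin n) ℂ) V)
    (X : Matrix (Fin n) (Fin n) ℂ) (v : V) : V :=
  if h : IsUnit X then ρ (h.unit⁻¹) v else 0

/-! ### The slash action -/

/-- The complex blocks `A, B, C, D` of an integral `2n × 2n` matrix. -/
def blkA {n : ℕ} (g : Matrix (Fin n ⊕ Fin n) (Fin n ⊕ Fin n) ℤ) : Matrix (Fin n) (Fin n) ℂ :=
  g.toBlocks₁₁.map (fun a => (a : ℂ))

/-- See `blkA`. -/
def blkB {n : ℕ} (g : Matrix (Fin n ⊕ Fin n) (Fin n ⊕ Fin n) ℤ) : Matrix (Fin n) (Fin n) ℂ :=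
  g.toBlocks₁₂.map (fun a => (a : ℂ))

/-- See `blkA`. -/
def blkC {n : ℕ} (g : Matrix (Fin n ⊕ Fin n) (Fin n ⊕ Fin n) ℤ) : Matrix (Fin n) (Fin n) ℂ :=
  g.toBlocks₂₁.map (fun a => (a : ℂ))

/-- See `blkA`. -/
def blkD {n : ℕ} (g : Matrix (Fin n ⊕ Fin n) (Fin n ⊕ Fin n) ℤ) : Matrix (Fin n) (Fin n) ℂ :=
  g.toBlocks₂₂.map (fun a => (a : ℂ))

/-- The function `f|_{ρ,𝓜}[(g,(l,μ;κ))]` on `ℍₙ × ℂ^{(m,n)}`, for an integral symplectic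
similitude `g` with multiplier `ν` and integral `(l,μ;κ)`:
`exp(-2πiν σ(𝓜 W (CΩ+D)⁻¹ C ᵗW)) exp(2πiν σ(𝓜(l Ω ᵗl + 2 l ᵗZ + κ + μ ᵗl)))`
`ρ(CΩ+D)⁻¹ f((AΩ+B)(CΩ+D)⁻¹, ν W (CΩ+D)⁻¹)` with `W = Z + l Ω + μ`.
For `ν = 1` this is the action of the Jacobi group; the factors `ν` are those which make the
action of similitudes compatible with products of matrices, and turn index `𝓜` into `ν𝓜`. -/
def slash {n m : ℕ} {V : Type*} [AddCommGroup V] [Module ℂ V]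
    (ρ : Representation ℂ (GeneralLinearGroup (Fin n) ℂ) V) (𝓜 : Matrix (Fin m) (Fin m) ℝ)
    (ν : ℕ) (g : Matrix (Fin n ⊕ Fin n) (Fin n ⊕ Fin n) ℤ)
    (l μ : Matrix (Fin m) (Fin n) ℤ) (κ : Matrix (Fin m) (Fin m) ℤ)
    (f : Matrix (Fin n) (Fin n) ℂ → Matrix (Fin m) (Fin n) ℂ → V) :
    Matrix (Fin n) (Fin n) ℂ → Matrix (Fin m) (Fin n) ℂ → V := fun Ω Z =>
  let lc : Matrix (Fin m) (Fin n) ℂ := l.map (fun a => (a : ℂ))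
  let μc : Matrix (Fin m) (Fin n) ℂ := μ.map (fun a => (a : ℂ))
  let κc : Matrix (Fin m) (Fin m) ℂ := κ.map (fun a => (a : ℂ))
  let Mc : Matrix (Fin m) (Fin m) ℂ := 𝓜.map (fun a => (a : ℂ))
  let W : Matrix (Fin m) (Fin n) ℂ := Z + lc * Ω + μc
  let j : Matrix (Fin n) (Fin n) ℂ := blkC g * Ω + blkD g
  Complex.exp (-(2 * Real.pi * Complex.I * ν * (Mc * W * j⁻¹ * blkC g * Wᵀ).trace)) •
    Complex.exp (2 * Real.pi * Complex.I * ν *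
        (Mc * (lc * Ω * lcᵀ + (2 : ℂ) • (lc * Zᵀ) + κc + μc * lcᵀ)).trace) •
      repInv ρ j (f ((blkA g * Ω + blkB g) * j⁻¹) ((ν : ℂ) • (W * j⁻¹)))

/-! ### Jacobi forms -/

/-- A real square matrix is half-integral if its diagonal entries and the doubles of all its
entries are integers. -/
def HalfIntegral {k : ℕ} (T : Matrix (Fin k) (Fin k) ℝ) : Prop :=
  (∀ i, ∃ a : ℤ, T i i = a) ∧ ∀ i j, ∃ a : ℤ, 2 * T i j = a

/-- The symmetric semi-positive definite half-integral `n × n` matrices. -/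
abbrev HalfIntPSD (n : ℕ) : Type :=
  {T : Matrix (Fin n) (Fin n) ℝ // T.PosSemidef ∧ HalfIntegral T}

/-- `F` has on `ℍₙ × ℂ^{(m,n)}` a Fourier expansion
`∑ c(T,R) exp((2πi/lam) σ(TΩ)) exp(2πi σ(RZ))`, over half-integral `T ≥ 0` and integral `R`,
with `c(T,R) ≠ 0` only if the matrix with blocks `T/lam`, `R/2`, `ᵗR/2`, `𝓜` is `≥ 0`. -/
def HasJacobiFourier {n m : ℕ} {V : Type*} [NormedAddCommGroup V] [NormedSpace ℂ V]
    (𝓜 : Matrix (Fin m) (Fin m) ℝ) (lam : ℤ)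
    (F : Matrix (Fin n) (Fin n) ℂ → Matrix (Fin m) (Fin n) ℂ → V) : Prop :=
  ∃ c : HalfIntPSD n → Matrix (Fin n) (Fin m) ℤ → V,
    (∀ (T : HalfIntPSD n) (R : Matrix (Fin n) (Fin m) ℤ), c T R ≠ 0 →
      (fromBlocks ((lam : ℝ)⁻¹ • T.1) ((2 : ℝ)⁻¹ • R.map (fun a => (a : ℝ)))
        ((2 : ℝ)⁻¹ • (R.map (fun a => (a : ℝ)))ᵀ) 𝓜).PosSemidef) ∧
    ∀ Ω ∈ siegelH n, ∀ Z : Matrix (Fin m) (Fin n) ℂ,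
      HasSum (fun x : HalfIntPSD n × Matrix (Fin n) (Fin m) ℤ =>
        (Complex.exp (2 * Real.pi * Complex.I / lam *
            (x.1.1.map (fun a => (a : ℂ)) * Ω).trace) *
          Complex.exp (2 * Real.pi * Complex.I * (x.2.map (fun a => (a : ℂ)) * Z).trace)) •
            c x.1 x.2)
        (F Ω Z)

/-- Jacobi forms of index `𝓜` with respect to `ρ` on a subgroup `Γ` of `Γₙ = Sp(n, ℤ)`.
A function on `ℍₙ × ℂ^{(m,n)}` is represented by a function on all pairs of complex matrices of
which only the values on `ℍₙ × ℂ^{(m,n)}` matter. As `ℍₙ` is open in the complex vector space of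
symmetric matrices, `holo` says that `f` is holomorphic there. -/
structure IsJacobiForm {n m : ℕ} {V : Type*} [NormedAddCommGroup V] [NormedSpace ℂ V]
    (ρ : Representation ℂ (GeneralLinearGroup (Fin n) ℂ) V) (𝓜 : Matrix (Fin m) (Fin m) ℝ)
    (Γ : Subgroup (symplecticGroup (Fin n) ℤ))
    (f : Matrix (Fin n) (Fin n) ℂ → Matrix (Fin m) (Fin n) ℂ → V) : Prop where
  holo : DifferentiableOn ℂ
    (fun x : Matrix (Fin n) (Fin n) ℂ × Matrix (Fin m) (Fin n) ℂ => f x.1 x.2)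
    (siegelH n ×ˢ Set.univ)
  invariant : ∀ γ ∈ Γ, ∀ (l μ : Matrix (Fin m) (Fin n) ℤ) (κ : Matrix (Fin m) (Fin m) ℤ),
    (κ + μ * lᵀ).IsSymm → ∀ Ω ∈ siegelH n, ∀ Z : Matrix (Fin m) (Fin n) ℂ,
      slash ρ 𝓜 1 (γ : Matrix (Fin n ⊕ Fin n) (Fin n ⊕ Fin n) ℤ) l μ κ f Ω Z = f Ω Z
  fourier : ∃ lam : ℤ, lam ≠ 0 ∧ ∀ γ : symplecticGroup (Fin n) ℤ,
    HasJacobiFourier 𝓜 lam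
      (slash ρ 𝓜 1 (γ : Matrix (Fin n ⊕ Fin n) (Fin n ⊕ Fin n) ℤ) 0 0 0 f)

/-! ### Cosets and the `p`-Hecke algebra -/

/-- `M` is a symplectic similitude with multiplier `ℓ`, i.e. `M ∈ Oₙ(ℓ)`. (The sign of `J` does
not matter.) -/
def IsSimilitude {n : ℕ} (ℓ : ℕ) (M : Matrix (Fin n ⊕ Fin n) (Fin n ⊕ Fin n) ℤ) : Prop :=
  Mᵀ * J (Fin n) ℤ * M = (ℓ : ℤ) • J (Fin n) ℤ

/-- `O_{n,p}`, the union of the sets `Oₙ(p^l)`, `l ≥ 0`. -/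
abbrev OSet (n p : ℕ) : Type :=
  {M : Matrix (Fin n ⊕ Fin n) (Fin n ⊕ Fin n) ℤ // ∃ l : ℕ, IsSimilitude (p ^ l) M}

/-- The multiplier `p^l` of an element of `O_{n,p}` (unique if `n ≥ 1`). -/
def OSet.mult {n p : ℕ} (M : OSet n p) : ℕ := p ^ M.2.choose

/-- `M ∼ M'` if and only if `Γₙ M = Γₙ M'`. -/
def leftSetoid (n p : ℕ) : Setoid (OSet n p) where
  r M M' := ∃ γ : symplecticGroup (Fin n) ℤ,
    M'.1 = (γ : Matrix (Fin n ⊕ Fin n) (Fin n ⊕ Fin n) ℤ) * M.1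
  iseqv :=
    { refl := fun M => ⟨1, by simp⟩
      symm := by
        rintro M M' ⟨γ, h⟩
        refine ⟨γ⁻¹, ?_⟩
        rw [h, ← Matrix.mul_assoc, ← Submonoid.coe_mul]
        simp
      trans := by
        rintro M M' M'' ⟨γ, h⟩ ⟨γ', h'⟩
        exact ⟨γ' * γ, by rw [h', h, Submonoid.coe_mul, Matrix.mul_assoc]⟩ }

/-- `M ∼ M'` if and only if `Γₙ M Γₙ = Γₙ M' Γₙ`. -/
def doubleSetoid (n p : ℕ) : Setoid (OSet n p) where
  r M M' := ∃ γ γ' : symplecticGroup (Fin n) ℤ,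
    M'.1 = (γ : Matrix (Fin n ⊕ Fin n) (Fin n ⊕ Fin n) ℤ) * M.1 * γ'.1
  iseqv :=
    { refl := fun M => ⟨1, 1, by simp⟩
      symm := by
        rintro M M' ⟨γ, δ, h⟩
        refine ⟨γ⁻¹, δ⁻¹, ?_⟩
        have h1 : (γ⁻¹).1 * γ.1 = 1 := by rw [← Submonoid.coe_mul]; simp
        have h2 : δ.1 * (δ⁻¹).1 = 1 := by rw [← Submonoid.coe_mul]; simp
        calc M.1 = ((γ⁻¹).1 * γ.1) * M.1 * (δ.1 * (δ⁻¹).1) := by rw [h1, h2]; simp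
          _ = _ := by rw [h]; simp only [Matrix.mul_assoc]
      trans := by
        rintro M M' M'' ⟨γ, δ, h⟩ ⟨γ', δ', h'⟩
        exact ⟨γ' * γ, δ * δ', by
          rw [h', h]; simp only [Submonoid.coe_mul, Matrix.mul_assoc]⟩ }

/-- The left cosets `Γₙ M`, `M ∈ O_{n,p}`. -/
abbrev LeftCoset (n p : ℕ) : Type := Quotient (leftSetoid n p)

/-- The double cosets `Γₙ M Γₙ`, `M ∈ O_{n,p}`. -/
abbrev DoubleCoset (n p : ℕ) : Type := Quotient (doubleSetoid n p)

/-- The left coset `Γₙ M`. -/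
def toLeft {n p : ℕ} (M : OSet n p) : LeftCoset n p := Quotient.mk _ M

/-- The double coset `Γₙ M Γₙ`. -/
def toDouble {n p : ℕ} (M : OSet n p) : DoubleCoset n p := Quotient.mk _ M

/-- The left cosets contained in a double coset. -/
def cosetsIn {n p : ℕ} (D : DoubleCoset n p) : Set (LeftCoset n p) :=
  {L | ∃ N : OSet n p, toDouble N = D ∧ toLeft N = L}

theorem toLeft_eq_of_map_eq {n p : ℕ} [Fact p.Prime] {l : ℕ} {M N : OSet n p}
    (hM : IsSimilitude (p ^ l) M.1) (hN : IsSimilitude (p ^ l) N.1)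
    (h : M.1.map (fun a => (a : ZMod (p ^ l))) = N.1.map (fun a => (a : ZMod (p ^ l)))) :
    toLeft M = toLeft N := by
  have hp : ((p ^ l : ℕ) : ℤ) ≠ 0 := by
    exact_mod_cast pow_ne_zero l (Fact.out : p.Prime).ne_zero
  set q : ℕ := p ^ l with hq
  have hJ : J (Fin n) ℤ * J (Fin n) ℤ = -1 := J_squared (Fin n) ℤ
  unfold IsSimilitude at hM hN
  set K : Matrix (Fin n ⊕ Fin n) (Fin n ⊕ Fin n) ℤ := -(J (Fin n) ℤ * M.1ᵀ * J (Fin n) ℤ)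
    with hK
  have hKM : K * M.1 = (q : ℤ) • 1 := by
    have : K * M.1 = -(J (Fin n) ℤ * (M.1ᵀ * J (Fin n) ℤ * M.1)) := by
      simp only [hK, Matrix.neg_mul, Matrix.mul_assoc]
    rw [this, hM, Matrix.mul_smul, hJ]
    simp
  have hdet : M.1.det ≠ 0 := by
    intro h0
    have h1 := congrArg Matrix.det hKM
    rw [Matrix.det_mul, h0, mul_zero, Matrix.det_smul, Matrix.det_one, mul_one] at h1
    exact pow_ne_zero _ hp h1.symm
  have cancel : ∀ X Y : Matrix (Fin n ⊕ Fin n) (Fin n ⊕ Fin n) ℤ,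
      X * M.1 = Y * M.1 → X = Y := by
    intro X Y hXY
    have h1 : X * M.1 * M.1.adjugate = Y * M.1 * M.1.adjugate := by rw [hXY]
    rw [Matrix.mul_assoc, Matrix.mul_assoc, Matrix.mul_adjugate, Matrix.mul_smul,
      Matrix.mul_smul, Matrix.mul_one, Matrix.mul_one] at h1
    exact smul_right_injective _ hdet h1
  have hex : ∃ X : Matrix (Fin n ⊕ Fin n) (Fin n ⊕ Fin n) ℤ, N.1 = M.1 + (q : ℤ) • X := by
    have : ∀ i j, ∃ x : ℤ, N.1 i j = M.1 i j + q * x := by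
      intro i j
      have h1 : ((M.1 i j : ℤ) : ZMod q) = ((N.1 i j : ℤ) : ZMod q) := by
        have := congrFun (congrFun h i) j
        simpa using this
      obtain ⟨x, hx⟩ := ((ZMod.intCast_eq_intCast_iff_dvd_sub _ _ _).1 h1)
      exact ⟨x, by linarith⟩
    choose X hX using this
    refine ⟨Matrix.of X, ?_⟩
    ext i j
    simp [hX]
  obtain ⟨X, hX⟩ := hex
  have hγ : (1 + X * K) * M.1 = N.1 := by
    rw [Matrix.add_mul, Matrix.one_mul, Matrix.mul_assoc, hKM, hX, Matrix.mul_smul,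
      Matrix.mul_one]
  have hmem : (1 + X * K) ∈ symplecticGroup (Fin n) ℤ := by
    rw [SymplecticGroup.mem_iff']
    set γ := 1 + X * K
    have h1 : M.1ᵀ * (γᵀ * J (Fin n) ℤ * γ) * M.1 = M.1ᵀ * J (Fin n) ℤ * M.1 := by
      rw [hM, ← hN, ← hγ]
      simp only [Matrix.transpose_mul, Matrix.mul_assoc]
    have h2 := cancel _ _ h1
    have h3 := congrArg Matrix.transpose h2
    rw [Matrix.transpose_mul, Matrix.transpose_mul M.1ᵀ, Matrix.transpose_transpose] at h3
    exact Matrix.transpose_injective (cancel _ _ h3)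
  exact Quotient.sound ⟨⟨_, hmem⟩, hγ.symm⟩

theorem cosetsIn_finite {n p : ℕ} [Fact p.Prime] (D : DoubleCoset n p) :
    (cosetsIn D).Finite := by
  induction D using Quotient.inductionOn with
  | h M =>
    obtain ⟨l, hl⟩ := M.2
    have hp : p ^ l ≠ 0 := pow_ne_zero l (Fact.out : p.Prime).ne_zero
    have : NeZero (p ^ l) := ⟨hp⟩
    have key : ∀ L ∈ cosetsIn (toDouble M),
        ∃ N : OSet n p, IsSimilitude (p ^ l) N.1 ∧ toLeft N = L := by
      rintro L ⟨N, hN, rfl⟩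
      refine ⟨N, ?_, rfl⟩
      obtain ⟨γ, δ, h⟩ := Quotient.exact hN.symm
      have hγ := SymplecticGroup.mem_iff'.1 γ.2
      have hδ := SymplecticGroup.mem_iff'.1 δ.2
      unfold IsSimilitude at hl ⊢
      rw [h]
      calc (γ.1 * M.1 * δ.1)ᵀ * J (Fin n) ℤ * (γ.1 * M.1 * δ.1)
          = δ.1ᵀ * (M.1ᵀ * (γ.1ᵀ * J (Fin n) ℤ * γ.1) * M.1) * δ.1 := by
            simp only [Matrix.transpose_mul, Matrix.mul_assoc]
        _ = _ := by rw [hγ, hl, Matrix.mul_smul, Matrix.smul_mul, hδ]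
    have : Nonempty (OSet n p) := ⟨M⟩
    choose! r hr hr' using key
    refine Set.Finite.of_finite_image
      (f := fun L => (r L).1.map (fun a => (a : ZMod (p ^ l)))) (Set.toFinite _) ?_
    intro L hL L' hL' h
    rw [← hr' L hL, ← hr' L' hL']
    exact toLeft_eq_of_map_eq (hr L hL) (hr L' hL') h

/-- The `ℂ`-module generated by the left cosets `Γₙ M`, `M ∈ O_{n,p}`. -/
abbrev LeftModule (n p : ℕ) : Type := LeftCoset n p →₀ ℂ

/-- The (underlying `ℂ`-module of the) `p`-Hecke algebra, generated by the double cosets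
`Γₙ M Γₙ`, `M ∈ O_{n,p}`. -/
abbrev HeckeModule (n p : ℕ) : Type := DoubleCoset n p →₀ ℂ

/-- The map `j` sending a double coset to the sum of the left cosets it consists of. -/
def heckeToLeft (n p : ℕ) [Fact p.Prime] : HeckeModule n p →ₗ[ℂ] LeftModule n p :=
  Finsupp.lift (LeftModule n p) ℂ (DoubleCoset n p) (fun D =>
    ∑ L ∈ (cosetsIn_finite D).toFinset, Finsupp.single L (1 : ℂ))

/-- `f|X` for `X` in the module of left cosets: the linear extension of
`f|(Γₙ M) = f|_{ρ,𝓜}[(M,(0,0;0))]`, which for a Jacobi form `f` does not depend on the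
representative `M`. -/
def slashLeft {n m p : ℕ} {V : Type*} [AddCommGroup V] [Module ℂ V]
    (ρ : Representation ℂ (GeneralLinearGroup (Fin n) ℂ) V) (𝓜 : Matrix (Fin m) (Fin m) ℝ)
    (f : Matrix (Fin n) (Fin n) ℂ → Matrix (Fin m) (Fin n) ℂ → V) (X : LeftModule n p) :
    Matrix (Fin n) (Fin n) ℂ → Matrix (Fin m) (Fin n) ℂ → V :=
  X.sum (fun L c => c • slash ρ 𝓜 (Quotient.out L).mult (Quotient.out L).1 0 0 0 f)

/-- `f|T = f|j(T)` for `T` in the `p`-Hecke algebra. -/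
def slashHecke {n m p : ℕ} [Fact p.Prime] {V : Type*} [AddCommGroup V] [Module ℂ V]
    (ρ : Representation ℂ (GeneralLinearGroup (Fin n) ℂ) V) (𝓜 : Matrix (Fin m) (Fin m) ℝ)
    (f : Matrix (Fin n) (Fin n) ℂ → Matrix (Fin m) (Fin n) ℂ → V) (T : HeckeModule n p) :
    Matrix (Fin n) (Fin n) ℂ → Matrix (Fin m) (Fin n) ℂ → V :=
  slashLeft ρ 𝓜 f (heckeToLeft n p T)

/-! ### The Zharkovskaya map -/

/-- The shape of the representatives in degree `N + 1` used to define the Zharkovskaya map: `C = 0`,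
`A` has the form `(a, ᵗα; 0, A*)`, `D` has the form `(d, 0; δ, D*)`, and `d > 0`. -/
structure IsReduced {N : ℕ}
    (M : Matrix (Fin (N + 1) ⊕ Fin (N + 1)) (Fin (N + 1) ⊕ Fin (N + 1)) ℤ) : Prop where
  C_eq : M.toBlocks₂₁ = 0
  A_col : ∀ i : Fin N, M.toBlocks₁₁ i.succ 0 = 0
  D_row : ∀ i : Fin N, M.toBlocks₂₂ 0 i.succ = 0
  d_pos : 0 < M.toBlocks₂₂ 0 0

/-- `M* = (A*, B*; 0, D*)`, where `A*, B*, D*` arise from `A, B, D` by deleting the first row and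
the first column. -/
def starMat {N : ℕ} (M : Matrix (Fin (N + 1) ⊕ Fin (N + 1)) (Fin (N + 1) ⊕ Fin (N + 1)) ℤ) :
    Matrix (Fin N ⊕ Fin N) (Fin N ⊕ Fin N) ℤ :=
  fromBlocks (M.toBlocks₁₁.submatrix Fin.succ Fin.succ) (M.toBlocks₁₂.submatrix Fin.succ Fin.succ)
    0 (M.toBlocks₂₂.submatrix Fin.succ Fin.succ)

theorem isSimilitude_starMat {N ℓ : ℕ}
    {M : Matrix (Fin (N + 1) ⊕ Fin (N + 1)) (Fin (N + 1) ⊕ Fin (N + 1)) ℤ}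
    (hr : IsReduced M) (h : IsSimilitude ℓ M) : IsSimilitude ℓ (starMat M) := by
  obtain ⟨hC, hA, hD, -⟩ := hr
  unfold IsSimilitude at h ⊢
  rw [← Matrix.fromBlocks_toBlocks M, hC] at h
  unfold starMat
  generalize M.toBlocks₁₁ = A at *
  generalize M.toBlocks₁₂ = B at *
  generalize M.toBlocks₂₂ = D at *
  simp only [J, fromBlocks_transpose, fromBlocks_multiply, fromBlocks_smul, fromBlocks_inj] at h ⊢
  obtain ⟨-, h2, h3, h4⟩ := h
  refine ⟨by simp, ?_, ?_, ?_⟩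
  · ext i j
    have := congrFun (congrFun h2 i.succ) j.succ
    simpa [Matrix.mul_apply, Fin.sum_univ_succ, hA, hD, Matrix.one_apply] using this
  · ext i j
    have := congrFun (congrFun h3 i.succ) j.succ
    simpa [Matrix.mul_apply, Fin.sum_univ_succ, hA, hD, Matrix.one_apply] using this
  · ext i j
    have := congrFun (congrFun h4 i.succ) j.succ
    simpa [Matrix.mul_apply, Fin.sum_univ_succ, hA, hD, Matrix.one_apply] using this

/-- `M*` as an element of `O_{N,p}`. -/
def starO {N p : ℕ} (M : OSet (N + 1) p) (hr : IsReduced M.1) : OSet N p :=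
  ⟨starMat M.1, M.2.choose, isSimilitude_starMat hr M.2.choose_spec⟩

open Classical in
/-- `(Γ M)* = d^{-r} Γ M*` for a representative `M` of the coset of the reduced shape. Every coset
contains such a representative, and the result does not depend on it. -/
def starCoset {N p : ℕ} (r : ℤ) (L : LeftCoset (N + 1) p) : LeftModule N p :=
  if h : ∃ M : OSet (N + 1) p, toLeft M = L ∧ IsReduced M.1 then
    Finsupp.single (toLeft (starO h.choose h.choose_spec.2))
      (((h.choose.1.toBlocks₂₂ 0 0 : ℤ) : ℂ) ^ (-r))
  else 0

/-- The linear extension `X ↦ X*` of `(Γ M)* = d^{-r} Γ M*`. -/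
def starLeft {N p : ℕ} (r : ℤ) : LeftModule (N + 1) p →ₗ[ℂ] LeftModule N p :=
  Finsupp.lift (LeftModule N p) ℂ (LeftCoset (N + 1) p) (starCoset r)

/-- `S = T*` under the Zharkovskaya map with parameter `r` from the `p`-Hecke algebra of degree
`N + 1` to that of degree `N`: if `Γ M Γ` is the disjoint union of the `Γ Mⱼ`, then
`(Γ M Γ)* = ∑ⱼ (Γ Mⱼ)*`, where elements of the Hecke algebras are identified with their images
under the injective maps `j`. So there is at most one such `S`. -/
def IsZharkovskaya {N p : ℕ} [Fact p.Prime] (r : ℤ) (T : HeckeModule (N + 1) p)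
    (S : HeckeModule N p) : Prop :=
  heckeToLeft N p S = starLeft r (heckeToLeft (N + 1) p T)

/-! ### The modified Siegel-Jacobi operator -/

/-- The block diagonal matrix `(w, 0; 0, X)`. -/
def diagBlock {N : ℕ} (w : ℂ) (X : Matrix (Fin N) (Fin N) ℂ) :
    Matrix (Fin (N + 1)) (Fin (N + 1)) ℂ :=
  Matrix.of (Fin.cons (Fin.cons w 0) (fun i => Fin.cons 0 (X i)))

theorem diagBlock_mul {N : ℕ} (w w' : ℂ) (X X' : Matrix (Fin N) (Fin N) ℂ) :
    diagBlock w X * diagBlock w' X' = diagBlock (w * w') (X * X') := by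
  ext i j
  refine Fin.cases ?_ (fun i => ?_) i <;> refine Fin.cases ?_ (fun j => ?_) j <;>
    simp [diagBlock, Matrix.mul_apply, Fin.sum_univ_succ]

theorem diagBlock_one {N : ℕ} : diagBlock 1 (1 : Matrix (Fin N) (Fin N) ℂ) = 1 := by
  ext i j
  refine Fin.cases ?_ (fun i => ?_) i <;> refine Fin.cases ?_ (fun j => ?_) j <;>
    simp [diagBlock, Matrix.one_apply, Fin.succ_ne_zero, (Fin.succ_ne_zero _).symm]

/-- The block diagonal matrix `(a, 0; 0, A)` in `GL(N + 1, ℂ)`. -/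
def diagGL {N : ℕ} (a : ℂˣ) (A : GeneralLinearGroup (Fin N) ℂ) :
    GeneralLinearGroup (Fin (N + 1)) ℂ where
  val := diagBlock a A.1
  inv := diagBlock (a⁻¹ : ℂˣ) (A⁻¹).1
  val_inv := by
    rw [diagBlock_mul, Units.mul_inv, show A.1 * (A⁻¹).1 = 1 from A.mul_inv, diagBlock_one]
  inv_val := by
    rw [diagBlock_mul, Units.inv_mul, show (A⁻¹).1 * A.1 = 1 from A.inv_mul, diagBlock_one]

/-- The matrix `(0, Z)`, i.e. `Z` with a zero column added on the left. -/
def zeroCol {m N : ℕ} (Z : Matrix (Fin m) (Fin N) ℂ) : Matrix (Fin m) (Fin (N + 1)) ℂ :=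
  Matrix.of (fun i => Fin.cons 0 (Z i))

/-- The function of `t` whose limit defines the modified Siegel-Jacobi operator. -/
def siegelPath {m N : ℕ} {V : Type*}
    (f : Matrix (Fin (N + 1)) (Fin (N + 1)) ℂ → Matrix (Fin m) (Fin (N + 1)) ℂ → V)
    (Ω : Matrix (Fin N) (Fin N) ℂ) (Z : Matrix (Fin m) (Fin N) ℂ) (t : ℝ) : V :=
  f (diagBlock (Complex.I * t) Ω) (zeroCol Z)

/-- The modified Siegel-Jacobi operator `Ψ⁰_{N+1,N}`:
`(Ψ⁰ f)(Ω, Z) = lim_{t → ∞} f((it, 0; 0, Ω), (0, Z))`. -/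
def siegelJacobi {m N : ℕ} {V : Type*} [NormedAddCommGroup V]
    (f : Matrix (Fin (N + 1)) (Fin (N + 1)) ℂ → Matrix (Fin m) (Fin (N + 1)) ℂ → V) :
    Matrix (Fin N) (Fin N) ℂ → Matrix (Fin m) (Fin N) ℂ → V := fun Ω Z =>
  limUnder atTop (siegelPath f Ω Z)

end SiegelJacobi

end

noncomputable section

namespace SiegelJacobi

open Matrix Filter

/-! ### Inverse values of a representation, and the slash action -/

section Slash

variable {n m : ℕ} {V : Type*} [AddCommGroup V] [Module ℂ V]
  (ρ : Representation ℂ (GeneralLinearGroup (Fin n) ℂ) V)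

/-! Write `e` for the first standard basis vector. In the Fourier expansion of `f`, adding `it` to
the upper left entry of `Ω` multiplies the term of `(T, R)` by `exp(-2π T₀₀ t / lam)`. As `t → ∞`,
only terms with `T₀₀ = 0` survive. For these, semi-definiteness makes the first row and column of
`T` and the first row of `R` vanish. So the limit exists at every point of `ℍ_{N+1}`, block diagonal
or not, and is a function `G` of the lower right block of `Ω` and the last columns of `Z`
(`HasJacobiFourier.exists_tendsto`, `IsJacobiForm.exists_tendsto`).

A reduced `M` with multiplier `ℓ` carries the path defining `Ψ⁰` to another path on which only the
upper left entry moves, at speed `a/d > 0`. Hence the limit of `f|M` is `ρ(D)⁻¹ G(M*Ω, ℓ Z (D*)⁻¹)`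
(`IsReduced.tendsto_siegelPath_slash`). Here `D` is the product of the unipotent matrix with column
`δ/d` and `diag(d, D*)`, and the two hypotheses on `R` handle only the second factor. The unipotent
factor acts trivially on values of `G`: invariance of `f` under the matrices `(ᵗU⁻¹, 0; 0, U)` gives
this for integral columns, and rationality of `ρ` extends it to complex multiples of these, because
a polynomial constant on the natural numbers is constant (`IsJacobiForm.apply_lowerUniGL_of_int`,
`IsRationalRep.apply_lowerUniGL`). So `R ρ(D)⁻¹` becomes `d^(-k) ρ₀(D*)⁻¹ R`, which is the weight in
`(ΓM)*`; summing over cosets gives the identity.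

The remaining work concerns representatives. Every coset has a reduced one because `Γₙ` moves any
integral vector to the line of `e` (`exists_symplectic_mulVec`, `exists_isReduced_of_exists`), and
the starred coset does not depend on it (`OSet.toLeft_down_eq`). Both `f` and `R ∘ Ψ⁰ f` are
invariant, so representatives may be exchanged on both sides. Finally, `T*` exists because the star
map commutes with right multiplication by `Γ_N`, and right invariant combinations of left cosets are
exactly those coming from double cosets (`starCoset_mulRight`, `exists_heckeToLeft_eq`). -/

theorem repInv_coe (g : GeneralLinearGroup (Fin n) ℂ) (v : V) :
    repInv ρ (g : Matrix (Fin n) (Fin n) ℂ) v = ρ g⁻¹ v := by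
  have h : IsUnit (g : Matrix (Fin n) (Fin n) ℂ) := g.isUnit
  have hg : h.unit = g := Units.ext rfl
  rw [repInv, dif_pos h, hg]

theorem repInv_of_not_isUnit {X : Matrix (Fin n) (Fin n) ℂ} (h : ¬IsUnit X) (v : V) :
    repInv ρ X v = 0 := dif_neg h

theorem repInv_one (v : V) : repInv ρ 1 v = v := by
  have := repInv_coe ρ 1 v
  simpa using this

/-- Only the right factor has to be invertible: for singular `X` both sides take the default value
`0`. This lets the cocycle computation below run without knowing that `CΩ + D` is invertible. -/
theorem repInv_mul (X : Matrix (Fin n) (Fin n) ℂ) {Y : Matrix (Fin n) (Fin n) ℂ}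
    (hY : IsUnit Y) (v : V) : repInv ρ (X * Y) v = repInv ρ Y (repInv ρ X v) := by
  obtain ⟨y, rfl⟩ := hY
  by_cases hX : IsUnit X
  · obtain ⟨x, rfl⟩ := hX
    have := repInv_coe ρ (x * y) v
    rw [Units.val_mul] at this
    rw [this, repInv_coe, repInv_coe, _root_.mul_inv_rev, map_mul]
    rfl
  · have hXY : ¬IsUnit (X * (y : Matrix (Fin n) (Fin n) ℂ)) := by
      rwa [Units.isUnit_mul_units]
    rw [repInv_of_not_isUnit ρ hX, repInv_of_not_isUnit ρ hXY, repInv_coe, map_zero]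

theorem repInv_smul (X : Matrix (Fin n) (Fin n) ℂ) (c : ℂ) (v : V) :
    repInv ρ X (c • v) = c • repInv ρ X v := by
  unfold repInv
  split_ifs <;> simp

theorem slash_zero (𝓜 : Matrix (Fin m) (Fin m) ℝ) (ν : ℕ)
    (g : Matrix (Fin n ⊕ Fin n) (Fin n ⊕ Fin n) ℤ)
    (f : Matrix (Fin n) (Fin n) ℂ → Matrix (Fin m) (Fin n) ℂ → V)
    (Ω : Matrix (Fin n) (Fin n) ℂ) (Z : Matrix (Fin m) (Fin n) ℂ) :
    slash ρ 𝓜 ν g 0 0 0 f Ω Z =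
      Complex.exp (-(2 * Real.pi * Complex.I * ν * (𝓜.map (fun a => (a : ℂ)) * Z *
        (blkC g * Ω + blkD g)⁻¹ * blkC g * Zᵀ).trace)) •
      repInv ρ (blkC g * Ω + blkD g) (f ((blkA g * Ω + blkB g) * (blkC g * Ω + blkD g)⁻¹)
        ((ν : ℂ) • (Z * (blkC g * Ω + blkD g)⁻¹))) := by
  have h0 : ∀ k : ℕ, (0 : Matrix (Fin m) (Fin k) ℤ).map (fun a => (a : ℂ)) = 0 := fun k => by
    ext; simp
  simp [slash, h0]

theorem slash_of_blkC_eq_zero (𝓜 : Matrix (Fin m) (Fin m) ℝ) (ν : ℕ)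
    {g : Matrix (Fin n ⊕ Fin n) (Fin n ⊕ Fin n) ℤ} (hg : blkC g = 0)
    (f : Matrix (Fin n) (Fin n) ℂ → Matrix (Fin m) (Fin n) ℂ → V)
    (Ω : Matrix (Fin n) (Fin n) ℂ) (Z : Matrix (Fin m) (Fin n) ℂ) :
    slash ρ 𝓜 ν g 0 0 0 f Ω Z =
      repInv ρ (blkD g) (f ((blkA g * Ω + blkB g) * (blkD g)⁻¹)
        ((ν : ℂ) • (Z * (blkD g)⁻¹))) := by
  rw [slash_zero, hg]
  simp

theorem blkA_mul (g h : Matrix (Fin n ⊕ Fin n) (Fin n ⊕ Fin n) ℤ) :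
    blkA (g * h) = blkA g * blkA h + blkB g * blkC h := by
  ext i j
  simp [blkA, blkB, blkC, Matrix.mul_apply, toBlocks₁₁, toBlocks₁₂, toBlocks₂₁]

theorem blkB_mul (g h : Matrix (Fin n ⊕ Fin n) (Fin n ⊕ Fin n) ℤ) :
    blkB (g * h) = blkA g * blkB h + blkB g * blkD h := by
  ext i j
  simp [blkA, blkB, blkD, Matrix.mul_apply, toBlocks₁₁, toBlocks₁₂, toBlocks₂₂]

theorem blkC_mul (g h : Matrix (Fin n ⊕ Fin n) (Fin n ⊕ Fin n) ℤ) :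
    blkC (g * h) = blkC g * blkA h + blkD g * blkC h := by
  ext i j
  simp [blkA, blkD, blkC, Matrix.mul_apply, toBlocks₁₁, toBlocks₂₂, toBlocks₂₁]

theorem blkD_mul (g h : Matrix (Fin n ⊕ Fin n) (Fin n ⊕ Fin n) ℤ) :
    blkD (g * h) = blkC g * blkB h + blkD g * blkD h := by
  ext i j
  simp [blkB, blkD, blkC, Matrix.mul_apply, toBlocks₁₂, toBlocks₂₂, toBlocks₂₁]

end Slash

/-! ### Similitudes with vanishing lower left block -/

section Similitude

variable {n ℓ : ℕ} {M : Matrix (Fin n ⊕ Fin n) (Fin n ⊕ Fin n) ℤ}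

theorem IsSimilitude.blocks (h : IsSimilitude ℓ M) (hC : M.toBlocks₂₁ = 0) :
    M.toBlocks₂₂ᵀ * M.toBlocks₁₁ = (ℓ : ℤ) • (1 : Matrix (Fin n) (Fin n) ℤ) ∧
      M.toBlocks₂₂ᵀ * M.toBlocks₁₂ = M.toBlocks₁₂ᵀ * M.toBlocks₂₂ := by
  unfold IsSimilitude at h
  rw [← Matrix.fromBlocks_toBlocks M, hC] at h
  simp only [J, fromBlocks_transpose, fromBlocks_multiply, fromBlocks_smul, fromBlocks_inj] at h
  obtain ⟨-, -, h3, h4⟩ := h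
  refine ⟨by simpa using h3, ?_⟩
  simp at h4
  rw [add_comm, neg_add_eq_zero] at h4
  exact h4.symm

theorem blkC_eq_zero (hC : M.toBlocks₂₁ = 0) : blkC M = 0 := by
  ext; simp [blkC, hC]

theorem IsSimilitude.blkD_transpose_mul_blkA (h : IsSimilitude ℓ M) (hC : M.toBlocks₂₁ = 0) :
    (blkD M)ᵀ * blkA M = (ℓ : ℂ) • (1 : Matrix (Fin n) (Fin n) ℂ) := by
  have := congrArg (fun X => X.map (Int.castRingHom ℂ)) (h.blocks hC).1
  simp only [Matrix.map_mul] at this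
  have h1 : ((ℓ : ℤ) • (1 : Matrix (Fin n) (Fin n) ℤ)).map (Int.castRingHom ℂ) = (ℓ : ℂ) • 1 := by
    ext i j
    simp only [Matrix.map_apply, Matrix.smul_apply, Matrix.one_apply]
    split_ifs <;> simp
  rw [← h1, ← this]
  rfl

theorem IsSimilitude.blkD_transpose_mul_blkB (h : IsSimilitude ℓ M) (hC : M.toBlocks₂₁ = 0) :
    (blkD M)ᵀ * blkB M = (blkB M)ᵀ * blkD M := by
  have := congrArg (fun X => X.map (Int.castRingHom ℂ)) (h.blocks hC).2
  simp only [Matrix.map_mul] at this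
  exact this

theorem IsSimilitude.isUnit_blkD (h : IsSimilitude ℓ M) (hC : M.toBlocks₂₁ = 0) (hℓ : ℓ ≠ 0) :
    IsUnit (blkD M) := by
  have h1 : ((ℓ : ℂ)⁻¹ • (blkA M)ᵀ) * blkD M = 1 := by
    have h2 := congrArg Matrix.transpose (h.blkD_transpose_mul_blkA hC)
    rw [Matrix.transpose_mul, Matrix.transpose_transpose] at h2
    rw [Matrix.smul_mul, h2]
    simp [smul_smul, hℓ]
  exact IsUnit.of_mul_eq_one_right _ h1

theorem IsSimilitude.blkA_eq (h : IsSimilitude ℓ M) (hC : M.toBlocks₂₁ = 0) (hℓ : ℓ ≠ 0) :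
    blkA M = (ℓ : ℂ) • ((blkD M)⁻¹)ᵀ := by
  have hD : IsUnit (blkD M).det := (Matrix.isUnit_iff_isUnit_det _).1 (h.isUnit_blkD hC hℓ)
  have hD' : IsUnit (blkD M)ᵀ.det := by rwa [Matrix.det_transpose]
  have h1 := congrArg (fun X => ((blkD M)ᵀ)⁻¹ * X) (h.blkD_transpose_mul_blkA hC)
  simp only [← Matrix.mul_assoc, Matrix.nonsing_inv_mul _ hD', Matrix.one_mul] at h1
  rw [h1, Matrix.transpose_nonsing_inv]
  simp

/-- The action of a similitude with vanishing lower left block preserves `ℍₙ`. -/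
theorem IsSimilitude.smul_mem_siegelH (h : IsSimilitude ℓ M) (hC : M.toBlocks₂₁ = 0) (hℓ : ℓ ≠ 0)
    {Ω : Matrix (Fin n) (Fin n) ℂ} (hΩ : Ω ∈ siegelH n) :
    (blkA M * Ω + blkB M) * (blkD M)⁻¹ ∈ siegelH n := by
  have hDu := h.isUnit_blkD hC hℓ
  have hD : IsUnit (blkD M).det := (Matrix.isUnit_iff_isUnit_det _).1 hDu
  have hD' : IsUnit (blkD M)ᵀ.det := by rwa [Matrix.det_transpose]
  set X := (blkA M * Ω + blkB M) * (blkD M)⁻¹ with hX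
  -- Conjugating by `D` clears the inverse. The right side is symmetric, and since `B` is real its
  -- imaginary part is `ℓ` times that of `Ω`; both defining properties of `ℍₙ` are read off from
  -- here.
  have key : (blkD M)ᵀ * X * blkD M = (ℓ : ℂ) • Ω + (blkD M)ᵀ * blkB M := by
    rw [hX, Matrix.mul_assoc, Matrix.nonsing_inv_mul_cancel_right _ _ hD, Matrix.mul_add,
      ← Matrix.mul_assoc, h.blkD_transpose_mul_blkA hC]
    simp
  have hsymm : X.IsSymm := by
    have h2 : (blkD M)ᵀ * Xᵀ * blkD M = (blkD M)ᵀ * X * blkD M := by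
      have h3 := congrArg Matrix.transpose key
      rw [Matrix.transpose_add, Matrix.transpose_smul, hΩ.1.eq, Matrix.transpose_mul _ (blkB M),
        Matrix.transpose_transpose, ← h.blkD_transpose_mul_blkB hC, ← key] at h3
      rw [← h3]
      simp [Matrix.mul_assoc]
    have h4 := congrArg (fun Y => ((blkD M)ᵀ)⁻¹ * (Y * (blkD M)⁻¹)) h2
    simp only [Matrix.mul_nonsing_inv_cancel_right _ _ hD, Matrix.mul_assoc] at h4
    simpa only [Matrix.IsSymm, Matrix.nonsing_inv_mul_cancel_left _ _ hD'] using h4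
  refine ⟨hsymm, ?_⟩
  set Dr : Matrix (Fin n) (Fin n) ℝ := M.toBlocks₂₂.map (fun a => (a : ℝ)) with hDr
  have hDmap : blkD M = Dr.map Complex.ofRealHom := by
    ext i j; simp [blkD, hDr]
  have hDrdet : IsUnit Dr.det := by
    rw [hDmap, ← RingHom.mapMatrix_apply, ← RingHom.map_det] at hD
    rw [isUnit_iff_ne_zero] at hD ⊢
    intro h0
    rw [h0] at hD
    simp at hD
  have him : Drᵀ * X.map Complex.im * Dr = (ℓ : ℝ) • Ω.map Complex.im := by
    ext i j
    have h5 := congrArg Complex.im (congrFun (congrFun key i) j)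
    simp only [Matrix.mul_apply, Matrix.transpose_apply, Matrix.add_apply, Matrix.smul_apply,
      hDmap, Matrix.map_apply, blkB, Complex.im_sum, Complex.add_im, Complex.ofRealHom_eq_coe,
      Complex.im_mul_ofReal, Complex.im_ofReal_mul, smul_eq_mul] at h5 ⊢
    rw [h5]
    have : ((ℓ : ℂ) * Ω i j).im = ℓ * (Ω i j).im := by simp
    rw [this, add_eq_left]
    exact Finset.sum_eq_zero fun x _ => by simp
  have hXim : X.map Complex.im = (Dr⁻¹)ᴴ * ((ℓ : ℝ) • Ω.map Complex.im) * Dr⁻¹ := by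
    have hDrt : IsUnit Drᵀ.det := by rwa [Matrix.det_transpose]
    rw [← him, Matrix.conjTranspose_eq_transpose_of_trivial, Matrix.transpose_nonsing_inv,
      Matrix.mul_assoc, Matrix.mul_nonsing_inv_cancel_right _ _ hDrdet,
      Matrix.nonsing_inv_mul_cancel_left _ _ hDrt]
  rw [hXim]
  refine (hΩ.2.smul (by positivity : (0 : ℝ) < ℓ)).conjTranspose_mul_mul_same ?_
  exact Matrix.mulVec_injective_of_isUnit
    ((Matrix.isUnit_iff_isUnit_det _).2 (Matrix.isUnit_nonsing_inv_det _ hDrdet))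

/-- `f|(γM) = f|M` if `f|γ = f` and the lower left block of `M` vanishes. -/
theorem slash_mul_of_invariant {m : ℕ} {V : Type*} [AddCommGroup V] [Module ℂ V]
    (ρ : Representation ℂ (GeneralLinearGroup (Fin n) ℂ) V) (𝓜 : Matrix (Fin m) (Fin m) ℝ)
    {f : Matrix (Fin n) (Fin n) ℂ → Matrix (Fin m) (Fin n) ℂ → V}
    {γ : Matrix (Fin n ⊕ Fin n) (Fin n ⊕ Fin n) ℤ}
    (hγ : ∀ Ω ∈ siegelH n, ∀ Z : Matrix (Fin m) (Fin n) ℂ, slash ρ 𝓜 1 γ 0 0 0 f Ω Z = f Ω Z)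
    (h : IsSimilitude ℓ M) (hC : M.toBlocks₂₁ = 0) (hℓ : ℓ ≠ 0)
    {Ω : Matrix (Fin n) (Fin n) ℂ} (hΩ : Ω ∈ siegelH n) (Z : Matrix (Fin m) (Fin n) ℂ) :
    slash ρ 𝓜 ℓ (γ * M) 0 0 0 f Ω Z = slash ρ 𝓜 ℓ M 0 0 0 f Ω Z := by
  have hDu := h.isUnit_blkD hC hℓ
  have hD : IsUnit (blkD M).det := (Matrix.isUnit_iff_isUnit_det _).1 hDu
  have hC' := blkC_eq_zero hC
  rw [slash_of_blkC_eq_zero ρ 𝓜 ℓ hC', ← hγ _ (h.smul_mem_siegelH hC hℓ hΩ), slash_zero, slash_zero,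
    repInv_smul, blkA_mul, blkB_mul, blkC_mul, blkD_mul, hC']
  set Ω' := (blkA M * Ω + blkB M) * (blkD M)⁻¹ with hΩ'
  have hΩD : Ω' * blkD M = blkA M * Ω + blkB M := Matrix.nonsing_inv_mul_cancel_right _ _ hD
  have hj : (blkC γ * blkA M + blkD γ * 0) * Ω + (blkC γ * blkB M + blkD γ * blkD M) =
      (blkC γ * Ω' + blkD γ) * blkD M := by
    rw [Matrix.add_mul _ (blkD γ), Matrix.mul_assoc (blkC γ), hΩD]
    simp only [Matrix.mul_add, Matrix.mul_assoc, Matrix.mul_zero, add_zero, add_assoc]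
  have hn : (blkA γ * blkA M + blkB γ * 0) * Ω + (blkA γ * blkB M + blkB γ * blkD M) =
      (blkA γ * Ω' + blkB γ) * blkD M := by
    rw [Matrix.add_mul _ (blkB γ), Matrix.mul_assoc (blkA γ), hΩD]
    simp only [Matrix.mul_add, Matrix.mul_assoc, Matrix.mul_zero, add_zero, add_assoc]
  rw [hj, hn, repInv_mul ρ _ hDu, Matrix.mul_inv_rev]
  congr 3
  -- The exponents agree because `A = ℓ ᵗD⁻¹`: the lower left block of `γM` is that of `γ` times
  -- `A`, while `Z` has been replaced by `ℓ Z D⁻¹`.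
  · rw [h.blkA_eq hC hℓ]
    simp [Matrix.mul_assoc, Matrix.mul_smul, Matrix.smul_mul, Matrix.trace_smul,
      Matrix.transpose_mul]
    ring
  · simp only [Nat.cast_one, one_smul, Matrix.smul_mul, ← Matrix.mul_assoc]
    rw [Matrix.mul_nonsing_inv_cancel_right _ _ hD]

end Similitude

/-! ### The limit along the upper left entry -/

/-- A vector isotropic for a semi-definite form lies in its kernel; here the vector is the `i`-th
basis vector. -/
theorem apply_eq_zero_of_posSemidef {ι : Type*} [Fintype ι] [DecidableEq ι] {P : Matrix ι ι ℝ}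
    (hP : P.PosSemidef) {i : ι} (hi : P i i = 0) (j : ι) : P i j = 0 ∧ P j i = 0 := by
  have h := (hP.dotProduct_mulVec_zero_iff (Pi.single i 1)).1 (by simp [hi])
  have h1 : P j i = 0 := by simpa using congrFun h j
  refine ⟨?_, h1⟩
  have h2 := congrFun (congrFun hP.isHermitian.eq i) j
  simpa [h1] using h2.symm

theorem trace_mul_eq_of_row_col_eq_zero {N : ℕ} {A B : Matrix (Fin (N + 1)) (Fin (N + 1)) ℂ}
    (h : ∀ j, A 0 j = 0 ∧ A j 0 = 0) :
    (A * B).trace =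
      (A.submatrix Fin.succ Fin.succ * B.submatrix Fin.succ Fin.succ).trace := by
  simp [Matrix.trace, Matrix.mul_apply, Fin.sum_univ_succ, (h _).1, (h _).2]

theorem trace_mul_eq_of_row_eq_zero {N m : ℕ} {A : Matrix (Fin (N + 1)) (Fin m) ℂ}
    {B : Matrix (Fin m) (Fin (N + 1)) ℂ} (h : ∀ j, A 0 j = 0) :
    (A * B).trace = (A.submatrix Fin.succ id * B.submatrix id Fin.succ).trace := by
  simp [Matrix.trace, Matrix.mul_apply, Fin.sum_univ_succ, h]

theorem trace_mul_add_single {N : ℕ} (A B : Matrix (Fin (N + 1)) (Fin (N + 1)) ℂ) (c : ℂ) :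
    (A * (B + Matrix.single 0 0 c)).trace = (A * B).trace + A 0 0 * c := by
  rw [Matrix.mul_add, Matrix.trace_add]
  simp [Matrix.trace, Matrix.mul_apply, Fin.sum_univ_succ, Matrix.single_apply,
    (Fin.succ_ne_zero _).symm]

/-- The function `(Ω', Z') ↦ ∑ c(T, R) e(σ(T'Ω')/lam) e(σ(R'Z'))`, the sum being over the pairs with
`T₀₀ = 0`, is the limit of a function with a Jacobi-Fourier expansion when the imaginary part of
the upper left entry of `Ω` tends to infinity. -/
theorem HasJacobiFourier.exists_tendsto {N m : ℕ} {V : Type*} [NormedAddCommGroup V]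
    [NormedSpace ℂ V] [FiniteDimensional ℂ V] {𝓜 : Matrix (Fin m) (Fin m) ℝ} {lam : ℤ}
    (hlam : lam ≠ 0)
    {F : Matrix (Fin (N + 1)) (Fin (N + 1)) ℂ → Matrix (Fin m) (Fin (N + 1)) ℂ → V}
    (hF : HasJacobiFourier 𝓜 lam F) :
    ∃ G : Matrix (Fin N) (Fin N) ℂ → Matrix (Fin m) (Fin N) ℂ → V,
      ∀ X : Matrix (Fin (N + 1)) (Fin (N + 1)) ℂ,
        (∀ t : ℝ, 0 ≤ t → X + Matrix.single 0 0 (Complex.I * t) ∈ siegelH (N + 1)) →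
        ∀ Z : Matrix (Fin m) (Fin (N + 1)) ℂ,
          Tendsto (fun t : ℝ => F (X + Matrix.single 0 0 (Complex.I * t)) Z) atTop
            (𝓝 (G (X.submatrix Fin.succ Fin.succ) (Z.submatrix id Fin.succ))) := by
  obtain ⟨c, hc, hsum⟩ := hF
  refine ⟨fun Ω' Z' => ∑' x : HalfIntPSD (N + 1) × Matrix (Fin (N + 1)) (Fin m) ℤ,
    if x.1.1 0 0 = 0 then
      (Complex.exp (2 * Real.pi * Complex.I / lam *
          ((x.1.1.map (fun a => (a : ℂ))).submatrix Fin.succ Fin.succ * Ω').trace) *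
        Complex.exp (2 * Real.pi * Complex.I *
          ((x.2.map (fun a => (a : ℂ))).submatrix Fin.succ id * Z').trace)) • c x.1 x.2
    else 0, ?_⟩
  intro X hX Z
  have hX0 : X ∈ siegelH (N + 1) := by
    have := hX 0 le_rfl
    simpa using this
  set E : HalfIntPSD (N + 1) × Matrix (Fin (N + 1)) (Fin m) ℤ → V := fun x =>
    (Complex.exp (2 * Real.pi * Complex.I / lam *
        (x.1.1.map (fun a => (a : ℂ)) * X).trace) *
      Complex.exp (2 * Real.pi * Complex.I * (x.2.map (fun a => (a : ℂ)) * Z).trace)) •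
        c x.1 x.2 with hE
  -- In finite dimension summability is absolute, so the terms at `t = 0` can serve as the
  -- dominating family.
  have hEs : Summable (fun x => ‖E x‖) := by
    have : FiniteDimensional ℝ V := FiniteDimensional.complexToReal V
    exact (hsum X hX0 Z).summable.norm
  have hterm : ∀ t : ℝ, ∀ x : HalfIntPSD (N + 1) × Matrix (Fin (N + 1)) (Fin m) ℤ,
      (Complex.exp (2 * Real.pi * Complex.I / lam *
        (x.1.1.map (fun a => (a : ℂ)) * (X + Matrix.single 0 0 (Complex.I * t))).trace) *
      Complex.exp (2 * Real.pi * Complex.I * (x.2.map (fun a => (a : ℂ)) * Z).trace)) •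
        c x.1 x.2 = Real.exp (-(2 * Real.pi * ((lam : ℝ)⁻¹ * x.1.1 0 0) * t)) • E x := by
    intro t x
    rw [trace_mul_add_single, Matrix.map_apply, mul_add, Complex.exp_add,
      ← Complex.coe_smul (Real.exp _), hE, smul_smul, Complex.ofReal_exp]
    have hexp : 2 * Real.pi * Complex.I / lam * (((x.1.1 0 0 : ℝ) : ℂ) * (Complex.I * t)) =
        ((-(2 * Real.pi * ((lam : ℝ)⁻¹ * x.1.1 0 0) * t) : ℝ) : ℂ) := by
      push_cast
      linear_combination (2 * Real.pi * (lam : ℂ)⁻¹ * (x.1.1 0 0 : ℝ) * t) * Complex.I_mul_I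
    rw [hexp]
    congr 1
    ring
  -- The sign of `lam` is not prescribed, so the nonnegativity of `T₀₀ / lam` is taken from the
  -- block matrix condition and not from `T ≥ 0`.
  have hpos : ∀ x : HalfIntPSD (N + 1) × Matrix (Fin (N + 1)) (Fin m) ℤ, c x.1 x.2 ≠ 0 →
      0 ≤ (lam : ℝ)⁻¹ * x.1.1 0 0 := by
    intro x hx
    have := (hc x.1 x.2 hx).diag_nonneg (i := Sum.inl 0)
    simpa using this
  have hrow : ∀ x : HalfIntPSD (N + 1) × Matrix (Fin (N + 1)) (Fin m) ℤ, c x.1 x.2 ≠ 0 →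
      x.1.1 0 0 = 0 → (∀ j, x.1.1 0 j = 0 ∧ x.1.1 j 0 = 0) ∧ ∀ j, x.2 0 j = 0 := by
    intro x hx h0
    refine ⟨apply_eq_zero_of_posSemidef x.1.2.1 h0, fun j => ?_⟩
    have := (apply_eq_zero_of_posSemidef (hc x.1 x.2 hx) (i := Sum.inl 0)
      (by simp [h0]) (Sum.inr j)).1
    simpa using this
  have hev : ∀ᶠ t : ℝ in atTop, (fun t : ℝ => ∑' x,
      Real.exp (-(2 * Real.pi * ((lam : ℝ)⁻¹ * x.1.1 0 0) * t)) • E x) t =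
        F (X + Matrix.single 0 0 (Complex.I * t)) Z := by
    filter_upwards [eventually_ge_atTop 0] with t ht
    rw [← (hsum _ (hX t ht) Z).tsum_eq]
    exact tsum_congr fun x => (hterm t x).symm
  refine Tendsto.congr' hev ?_
  -- Each term is its value at `t = 0` times a factor which is at most `1` and which tends to `0`
  -- unless `T₀₀ = 0`.
  refine tendsto_tsum_of_dominated_convergence hEs ?_ ?_
  · intro x
    by_cases hx : c x.1 x.2 = 0
    · simp [hE, hx]
    split_ifs with h0
    · obtain ⟨hT, hR⟩ := hrow x hx h0
      simp only [h0, mul_zero, zero_mul, neg_zero, Real.exp_zero, one_smul]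
      simp only [hE]
      rw [trace_mul_eq_of_row_col_eq_zero (A := x.1.1.map (fun a => (a : ℂ)))
        (fun j => by simp [(hT j).1, (hT j).2]),
        trace_mul_eq_of_row_eq_zero (A := x.2.map (fun a => (a : ℂ))) (fun j => by simp [hR j])]
      exact tendsto_const_nhds
    · have hlt : 0 < 2 * Real.pi * ((lam : ℝ)⁻¹ * x.1.1 0 0) := by
        have h1 : (lam : ℝ)⁻¹ * x.1.1 0 0 ≠ 0 :=
          mul_ne_zero (inv_ne_zero (by exact_mod_cast hlam)) h0
        have := lt_of_le_of_ne (hpos x hx) h1.symm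
        have := Real.pi_pos
        positivity
      rw [← zero_smul ℝ (E x)]
      refine Tendsto.smul_const ?_ _
      exact Real.tendsto_exp_neg_atTop_nhds_zero.comp (tendsto_id.const_mul_atTop hlt)
  · filter_upwards [eventually_ge_atTop 0] with t ht x
    by_cases hx : c x.1 x.2 = 0
    · simp [hE, hx]
    rw [norm_smul, Real.norm_eq_abs, Real.abs_exp]
    refine mul_le_of_le_one_left (norm_nonneg _) ?_
    rw [Real.exp_le_one_iff, neg_nonpos]
    have := hpos x hx
    have := Real.pi_pos
    positivity

/-! ### Paths in the upper half plane and the limit function of a Jacobi form -/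

theorem add_single_mem_siegelH {N : ℕ} {X : Matrix (Fin (N + 1)) (Fin (N + 1)) ℂ}
    (hX : X ∈ siegelH (N + 1)) {t : ℝ} (ht : 0 ≤ t) :
    X + Matrix.single 0 0 (Complex.I * t) ∈ siegelH (N + 1) := by
  refine ⟨?_, ?_⟩
  · refine hX.1.add ?_
    simp [Matrix.IsSymm]
  · have h1 : (X + Matrix.single 0 0 (Complex.I * t)).map Complex.im =
        X.map Complex.im + Matrix.diagonal (Pi.single 0 t) := by
      rw [Matrix.diagonal_single]
      ext i j
      by_cases h : (0 : Fin (N + 1)) = i ∧ 0 = j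
      · obtain ⟨rfl, rfl⟩ := h
        simp
      · simp [Matrix.single_apply_of_ne _ _ _ _ _ h]
    rw [h1]
    exact hX.2.add_posSemidef (Matrix.PosSemidef.diagonal (by
      intro i
      by_cases h : i = 0
      · subst h; simpa using ht
      · simp [h]))

theorem diagBlock_mem_siegelH {N : ℕ} {Ω : Matrix (Fin N) (Fin N) ℂ} (hΩ : Ω ∈ siegelH N)
    {t : ℝ} (ht : 0 < t) : diagBlock (Complex.I * t) Ω ∈ siegelH (N + 1) := by
  refine ⟨?_, ?_⟩
  · ext i j
    refine Fin.cases ?_ (fun i => ?_) i <;> refine Fin.cases ?_ (fun j => ?_) j <;>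
      simp [diagBlock, hΩ.1.apply]
  · have hs : ((diagBlock (Complex.I * t) Ω).map Complex.im).IsHermitian := by
      ext i j
      refine Fin.cases ?_ (fun i => ?_) i <;> refine Fin.cases ?_ (fun j => ?_) j <;>
        simp [diagBlock, hΩ.1.apply]
    refine Matrix.PosDef.of_dotProduct_mulVec_pos hs fun x hx => ?_
    have h1 : star x ⬝ᵥ ((diagBlock (Complex.I * t) Ω).map Complex.im *ᵥ x) =
        t * x 0 ^ 2 + star (fun i : Fin N => x i.succ) ⬝ᵥ
          ((Ω.map Complex.im) *ᵥ (fun i : Fin N => x i.succ)) := by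
      simp [dotProduct, Matrix.mulVec, Fin.sum_univ_succ, diagBlock]
      ring
    rw [h1]
    by_cases h0 : (fun i : Fin N => x i.succ) = 0
    · have hx0 : x 0 ≠ 0 := by
        intro h
        apply hx
        ext i
        exact Fin.cases h (fun i => congrFun h0 i) i
      rw [h0]
      simp only [star_zero, zero_dotProduct, add_zero]
      positivity
    · have := hΩ.2.dotProduct_mulVec_pos h0
      positivity

theorem slash_one_one {n m : ℕ} {V : Type*} [AddCommGroup V] [Module ℂ V]
    (ρ : Representation ℂ (GeneralLinearGroup (Fin n) ℂ) V) (𝓜 : Matrix (Fin m) (Fin m) ℝ)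
    (f : Matrix (Fin n) (Fin n) ℂ → Matrix (Fin m) (Fin n) ℂ → V) :
    slash ρ 𝓜 1 1 0 0 0 f = f := by
  have hA : blkA (1 : Matrix (Fin n ⊕ Fin n) (Fin n ⊕ Fin n) ℤ) = 1 := by
    ext i j; simp [blkA, Matrix.one_apply, toBlocks₁₁]
  have hD : blkD (1 : Matrix (Fin n ⊕ Fin n) (Fin n ⊕ Fin n) ℤ) = 1 := by
    ext i j; simp [blkD, Matrix.one_apply, toBlocks₂₂]
  have hB : blkB (1 : Matrix (Fin n ⊕ Fin n) (Fin n ⊕ Fin n) ℤ) = 0 := by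
    ext i j; simp [blkB, toBlocks₁₂]
  have hC : blkC (1 : Matrix (Fin n ⊕ Fin n) (Fin n ⊕ Fin n) ℤ) = 0 := by
    ext i j; simp [blkC, toBlocks₂₁]
  funext Ω Z
  rw [slash_of_blkC_eq_zero ρ 𝓜 1 hC, hA, hB, hD, repInv_one]
  simp

/-- The limit is needed at all points of `ℍ_{N+1}` and with an arbitrary first column of `Z`,
because a reduced similitude moves the path off the block diagonal matrices and `(0, Z)` off the
matrices with zero first column. Only the expansion at `γ = 1` enters. -/
theorem IsJacobiForm.exists_tendsto {N m : ℕ} {V : Type*} [NormedAddCommGroup V]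
    [NormedSpace ℂ V] [FiniteDimensional ℂ V] {𝓜 : Matrix (Fin m) (Fin m) ℝ}
    {ρ : Representation ℂ (GeneralLinearGroup (Fin (N + 1)) ℂ) V}
    {Γ : Subgroup (symplecticGroup (Fin (N + 1)) ℤ)}
    {f : Matrix (Fin (N + 1)) (Fin (N + 1)) ℂ → Matrix (Fin m) (Fin (N + 1)) ℂ → V}
    (hf : IsJacobiForm ρ 𝓜 Γ f) :
    ∃ G : Matrix (Fin N) (Fin N) ℂ → Matrix (Fin m) (Fin N) ℂ → V,
      ∀ X ∈ siegelH (N + 1), ∀ Z : Matrix (Fin m) (Fin (N + 1)) ℂ,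
          Tendsto (fun t : ℝ => f (X + Matrix.single 0 0 (Complex.I * t)) Z) atTop
            (𝓝 (G (X.submatrix Fin.succ Fin.succ) (Z.submatrix id Fin.succ))) := by
  obtain ⟨lam, hlam, h⟩ := hf.fourier
  have h1 := h 1
  rw [OneMemClass.coe_one, slash_one_one] at h1
  obtain ⟨G, hG⟩ := h1.exists_tendsto hlam
  exact ⟨G, fun X hX => hG X fun t ht => add_single_mem_siegelH hX ht⟩

theorem diagBlock_eq_add_single {N : ℕ} (s t : ℂ) (Ω : Matrix (Fin N) (Fin N) ℂ) :
    diagBlock (s + t) Ω = diagBlock s Ω + Matrix.single 0 0 t := by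
  ext i j
  refine Fin.cases ?_ (fun i => ?_) i <;> refine Fin.cases ?_ (fun j => ?_) j <;>
    simp [diagBlock, (Fin.succ_ne_zero _).symm]

theorem diagBlock_submatrix {N : ℕ} (s : ℂ) (Ω : Matrix (Fin N) (Fin N) ℂ) :
    (diagBlock s Ω).submatrix Fin.succ Fin.succ = Ω := by
  ext i j
  simp [diagBlock]

theorem zeroCol_submatrix {N m : ℕ} (Z : Matrix (Fin m) (Fin N) ℂ) :
    (zeroCol Z).submatrix id Fin.succ = Z := by
  ext i j
  simp [zeroCol]

theorem tendsto_siegelPath {N m : ℕ} {V : Type*} [NormedAddCommGroup V]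
    {f : Matrix (Fin (N + 1)) (Fin (N + 1)) ℂ → Matrix (Fin m) (Fin (N + 1)) ℂ → V}
    {G : Matrix (Fin N) (Fin N) ℂ → Matrix (Fin m) (Fin N) ℂ → V}
    (hG : ∀ X ∈ siegelH (N + 1), ∀ Z : Matrix (Fin m) (Fin (N + 1)) ℂ,
      Tendsto (fun t : ℝ => f (X + Matrix.single 0 0 (Complex.I * t)) Z) atTop
        (𝓝 (G (X.submatrix Fin.succ Fin.succ) (Z.submatrix id Fin.succ))))
    {Ω : Matrix (Fin N) (Fin N) ℂ} (hΩ : Ω ∈ siegelH N) (Z : Matrix (Fin m) (Fin N) ℂ) :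
    Tendsto (siegelPath f Ω Z) atTop (𝓝 (G Ω Z)) := by
  have h1 := hG _ (diagBlock_mem_siegelH hΩ one_pos) (zeroCol Z)
  rw [diagBlock_submatrix, zeroCol_submatrix] at h1
  -- The path starts at `t = 0` outside `ℍ_{N+1}`, so the base point is taken at `t = 1` and the
  -- parameter is shifted by `-1`.
  refine (h1.comp (tendsto_atTop_add_const_right atTop (-1) tendsto_id)).congr fun t => ?_
  simp only [siegelPath, Function.comp, id, ← diagBlock_eq_add_single]
  congr 2
  push_cast
  ring

/-! ### Representatives of the reduced shape -/

section Reduced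

variable {N ℓ : ℕ} {M : Matrix (Fin (N + 1) ⊕ Fin (N + 1)) (Fin (N + 1) ⊕ Fin (N + 1)) ℤ}

theorem starMat_toBlocks₂₁ : (starMat M).toBlocks₂₁ = 0 := by
  simp [starMat]

theorem blkA_starMat : blkA (starMat M) = (blkA M).submatrix Fin.succ Fin.succ := by
  ext i j; simp [blkA, starMat]

theorem blkB_starMat : blkB (starMat M) = (blkB M).submatrix Fin.succ Fin.succ := by
  ext i j; simp [blkB, starMat]

theorem blkD_starMat : blkD (starMat M) = (blkD M).submatrix Fin.succ Fin.succ := by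
  ext i j; simp [blkD, starMat]

theorem IsReduced.blkA_col (hr : IsReduced M) (i : Fin N) : blkA M i.succ 0 = 0 := by
  simp [blkA, hr.A_col]

theorem IsReduced.blkD_row (hr : IsReduced M) (i : Fin N) : blkD M 0 i.succ = 0 := by
  simp [blkD, hr.D_row]

theorem IsReduced.mul_eq (hr : IsReduced M) (h : IsSimilitude ℓ M) :
    M.toBlocks₂₂ 0 0 * M.toBlocks₁₁ 0 0 = ℓ := by
  have := congrFun (congrFun (h.blocks hr.C_eq).1 0) 0
  rw [Matrix.mul_apply, Fin.sum_univ_succ] at this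
  simpa only [Matrix.transpose_apply, hr.A_col, mul_zero, Finset.sum_const_zero, add_zero,
    Matrix.smul_apply, Matrix.one_apply_eq, smul_eq_mul, mul_one] using this

theorem IsReduced.a_pos (hr : IsReduced M) (h : IsSimilitude ℓ M) (hℓ : ℓ ≠ 0) :
    0 < M.toBlocks₁₁ 0 0 := by
  have h1 := hr.mul_eq h
  have h2 := hr.d_pos
  have h3 : (0 : ℤ) < ℓ := by positivity
  rw [← h1] at h3
  exact (mul_pos_iff_of_pos_left h2).1 h3

/-- The first column of `A` is `a e` and the first row of `D` is `d ᵗe`, so multiplying the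
elementary matrix at the upper left corner by `A` and `D⁻¹` only rescales it. The factor `a/d` is
the speed of the transformed path. -/
theorem IsReduced.blkA_mul_single (hr : IsReduced M) (h : IsSimilitude ℓ M) (hℓ : ℓ ≠ 0) (c : ℂ) :
    blkA M * Matrix.single 0 0 c * (blkD M)⁻¹ =
      Matrix.single 0 0 (c * (M.toBlocks₁₁ 0 0 / M.toBlocks₂₂ 0 0)) := by
  have hD : IsUnit (blkD M).det :=
    (Matrix.isUnit_iff_isUnit_det _).1 (h.isUnit_blkD hr.C_eq hℓ)
  have hd : ((M.toBlocks₂₂ 0 0 : ℤ) : ℂ) ≠ 0 := by exact_mod_cast hr.d_pos.ne'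
  have h1 : blkA M * Matrix.single 0 0 c =
      Matrix.single 0 0 (c * (M.toBlocks₁₁ 0 0 / M.toBlocks₂₂ 0 0)) * blkD M := by
    ext i j
    refine Fin.cases ?_ (fun i => ?_) i <;> refine Fin.cases ?_ (fun j => ?_) j <;>
      simp [Matrix.mul_apply, Matrix.single_apply, hr.blkA_col, hr.blkD_row,
        (Fin.succ_ne_zero _).symm]
    simp only [blkA, blkD, Matrix.map_apply]
    field_simp
  rw [h1, Matrix.mul_nonsing_inv_cancel_right _ _ hD]

/-- After multiplication by `D` on the right, the zeros in the first column of `A` and the first row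
of `D` remove every contribution of the first index to the lower right block. In particular the
result is independent of `s`. -/
theorem IsReduced.submatrix_smul (hr : IsReduced M) (h : IsSimilitude ℓ M) (hℓ : ℓ ≠ 0) (s : ℂ)
    (Ω : Matrix (Fin N) (Fin N) ℂ) :
    ((blkA M * diagBlock s Ω + blkB M) * (blkD M)⁻¹).submatrix Fin.succ Fin.succ =
      (blkA (starMat M) * Ω + blkB (starMat M)) * (blkD (starMat M))⁻¹ := by
  have hD : IsUnit (blkD M).det :=
    (Matrix.isUnit_iff_isUnit_det _).1 (h.isUnit_blkD hr.C_eq hℓ)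
  have hD' : IsUnit (blkD (starMat M)).det := (Matrix.isUnit_iff_isUnit_det _).1
    ((isSimilitude_starMat hr h).isUnit_blkD starMat_toBlocks₂₁ hℓ)
  set X := (blkA M * diagBlock s Ω + blkB M) * (blkD M)⁻¹ with hX
  have hXD : X * blkD M = blkA M * diagBlock s Ω + blkB M :=
    Matrix.nonsing_inv_mul_cancel_right _ _ hD
  have h1 : X.submatrix Fin.succ Fin.succ * blkD (starMat M) =
      blkA (starMat M) * Ω + blkB (starMat M) := by
    ext i j
    have := congrFun (congrFun hXD i.succ) j.succ
    simpa [Matrix.mul_apply, Fin.sum_univ_succ, hr.blkD_row, hr.blkA_col, diagBlock,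
      blkA_starMat, blkB_starMat, blkD_starMat] using this
  rw [← h1, Matrix.mul_nonsing_inv_cancel_right _ _ hD']

theorem IsReduced.submatrix_zeroCol {m : ℕ} (hr : IsReduced M) (h : IsSimilitude ℓ M) (hℓ : ℓ ≠ 0)
    (Z : Matrix (Fin m) (Fin N) ℂ) :
    ((ℓ : ℂ) • (zeroCol Z * (blkD M)⁻¹)).submatrix id Fin.succ =
      (ℓ : ℂ) • (Z * (blkD (starMat M))⁻¹) := by
  have hD : IsUnit (blkD M).det :=
    (Matrix.isUnit_iff_isUnit_det _).1 (h.isUnit_blkD hr.C_eq hℓ)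
  have hD' : IsUnit (blkD (starMat M)).det := (Matrix.isUnit_iff_isUnit_det _).1
    ((isSimilitude_starMat hr h).isUnit_blkD starMat_toBlocks₂₁ hℓ)
  set X := zeroCol Z * (blkD M)⁻¹ with hX
  have hXD : X * blkD M = zeroCol Z := Matrix.nonsing_inv_mul_cancel_right _ _ hD
  have h1 : X.submatrix id Fin.succ * blkD (starMat M) = Z := by
    ext i j
    have := congrFun (congrFun hXD i) j.succ
    simpa [Matrix.mul_apply, Fin.sum_univ_succ, hr.blkD_row, zeroCol, blkD_starMat] using this
  rw [← h1, Matrix.mul_nonsing_inv_cancel_right _ _ hD']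
  rfl

theorem continuous_repInv {n : ℕ} {V : Type*} [NormedAddCommGroup V] [NormedSpace ℂ V]
    [FiniteDimensional ℂ V] (ρ : Representation ℂ (GeneralLinearGroup (Fin n) ℂ) V)
    (X : Matrix (Fin n) (Fin n) ℂ) : Continuous (repInv ρ X) := by
  by_cases hX : IsUnit X
  · obtain ⟨g, rfl⟩ := hX
    have : repInv ρ (g : Matrix (Fin n) (Fin n) ℂ) = ρ g⁻¹ := funext (repInv_coe ρ g)
    rw [this]
    exact LinearMap.continuous_of_finiteDimensional _
  · have : repInv ρ X = fun _ => 0 := funext (repInv_of_not_isUnit ρ hX)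
    rw [this]
    exact continuous_const

variable {m : ℕ} {V : Type*} [NormedAddCommGroup V] [NormedSpace ℂ V] [FiniteDimensional ℂ V]
  (ρ : Representation ℂ (GeneralLinearGroup (Fin (N + 1)) ℂ) V) (𝓜 : Matrix (Fin m) (Fin m) ℝ)
  {f : Matrix (Fin (N + 1)) (Fin (N + 1)) ℂ → Matrix (Fin m) (Fin (N + 1)) ℂ → V}
  {G : Matrix (Fin N) (Fin N) ℂ → Matrix (Fin m) (Fin N) ℂ → V}

/-- With `C = 0` the exponential factor is trivial and `ρ(D)⁻¹` is a fixed continuous map. What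
remains is the limit of `f` along a path whose upper left entry alone moves, which is governed by
`G`. -/
theorem IsReduced.tendsto_siegelPath_slash (hr : IsReduced M) (h : IsSimilitude ℓ M) (hℓ : ℓ ≠ 0)
    (hG : ∀ X ∈ siegelH (N + 1), ∀ Z : Matrix (Fin m) (Fin (N + 1)) ℂ,
      Tendsto (fun t : ℝ => f (X + Matrix.single 0 0 (Complex.I * t)) Z) atTop
        (𝓝 (G (X.submatrix Fin.succ Fin.succ) (Z.submatrix id Fin.succ))))
    {Ω : Matrix (Fin N) (Fin N) ℂ} (hΩ : Ω ∈ siegelH N) (Z : Matrix (Fin m) (Fin N) ℂ) :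
    Tendsto (siegelPath (slash ρ 𝓜 ℓ M 0 0 0 f) Ω Z) atTop
      (𝓝 (repInv ρ (blkD M) (G ((blkA (starMat M) * Ω + blkB (starMat M)) * (blkD (starMat M))⁻¹)
        ((ℓ : ℂ) • (Z * (blkD (starMat M))⁻¹))))) := by
  set r : ℝ := (M.toBlocks₁₁ 0 0 : ℝ) / (M.toBlocks₂₂ 0 0 : ℝ) with hr'
  have hr0 : 0 < r := div_pos (by exact_mod_cast hr.a_pos h hℓ) (by exact_mod_cast hr.d_pos)
  have h1 := hG _ (h.smul_mem_siegelH hr.C_eq hℓ (diagBlock_mem_siegelH hΩ one_pos))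
    ((ℓ : ℂ) • (zeroCol Z * (blkD M)⁻¹))
  rw [hr.submatrix_smul h hℓ, hr.submatrix_zeroCol h hℓ] at h1
  -- The transformed path has parameter `(t - 1) a/d`; positivity of `a/d` sends it to `+∞`.
  have h2 : Tendsto (fun t : ℝ => (t + -1) * r) atTop atTop :=
    (tendsto_atTop_add_const_right atTop (-1) tendsto_id).atTop_mul_const hr0
  refine (((continuous_repInv ρ (blkD M)).tendsto _).comp (h1.comp h2)).congr fun t => ?_
  simp only [siegelPath, Function.comp]
  rw [slash_of_blkC_eq_zero ρ 𝓜 ℓ (blkC_eq_zero hr.C_eq)]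
  congr 2
  have h3 : diagBlock (Complex.I * t) Ω =
      diagBlock (Complex.I * (1 : ℝ)) Ω + Matrix.single 0 0 (Complex.I * (t + -1)) := by
    rw [← diagBlock_eq_add_single]
    congr 1
    push_cast
    ring
  rw [h3, Matrix.mul_add, add_right_comm, Matrix.add_mul (_ + _), hr.blkA_mul_single h hℓ]
  congr 2
  rw [hr']
  push_cast
  ring

end Reduced

/-! ### Unipotent matrices -/

/-- The unipotent matrix `(1, 0; x, 1)`. -/
def lowerUni {N : ℕ} {K : Type*} [CommRing K] (x : Fin N → K) :
    Matrix (Fin (N + 1)) (Fin (N + 1)) K :=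
  Matrix.of (Fin.cons (Fin.cons 1 0) (fun i => Fin.cons (x i) ((1 : Matrix (Fin N) (Fin N) K) i)))

section LowerUni

variable {N : ℕ} {K : Type*} [CommRing K]

theorem lowerUni_mul (x y : Fin N → K) : lowerUni x * lowerUni y = lowerUni (x + y) := by
  ext i j
  refine Fin.cases ?_ (fun i => ?_) i <;> refine Fin.cases ?_ (fun j => ?_) j <;>
    simp [lowerUni, Matrix.mul_apply, Fin.sum_univ_succ, Matrix.one_apply]

theorem lowerUni_zero : lowerUni (0 : Fin N → K) = 1 := by
  ext i j
  refine Fin.cases ?_ (fun i => ?_) i <;> refine Fin.cases ?_ (fun j => ?_) j <;>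
    simp [lowerUni, Matrix.one_apply, (Fin.succ_ne_zero _).symm]

/-- The unipotent matrix `(1, 0; x, 1)` in `GL(N + 1)`. -/
def lowerUniGL (x : Fin N → K) : GeneralLinearGroup (Fin (N + 1)) K where
  val := lowerUni x
  inv := lowerUni (-x)
  val_inv := by rw [lowerUni_mul, add_neg_cancel, lowerUni_zero]
  inv_val := by rw [lowerUni_mul, neg_add_cancel, lowerUni_zero]

theorem det_lowerUni (x : Fin N → K) : (lowerUni x).det = 1 := by
  have h : (lowerUni x).BlockTriangular OrderDual.toDual := by
    intro i j hij
    have hij' : i < j := hij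
    revert hij'
    refine Fin.cases ?_ (fun i => ?_) i <;> refine Fin.cases ?_ (fun j => ?_) j <;> intro hij'
    · simp at hij'
    · simp [lowerUni]
    · simp at hij'
    · have : i ≠ j := by rintro rfl; simp at hij'
      simp [lowerUni, this]
  rw [Matrix.det_of_isLowerTriangular _ h]
  refine Finset.prod_eq_one fun i _ => ?_
  refine Fin.cases ?_ (fun i => ?_) i <;> simp [lowerUni]

end LowerUni

/-- A vector fixed by the unipotent matrices with integral entries is fixed by all unipotent
matrices on the complex lines through the integral points. -/
theorem IsRationalRep.apply_lowerUniGL {N : ℕ} {V : Type*} [AddCommGroup V] [Module ℂ V]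
    {ρ : Representation ℂ (GeneralLinearGroup (Fin (N + 1)) ℂ) V} (hρ : IsRationalRep ρ) {v : V}
    (hv : ∀ x : Fin N → ℤ, ρ (lowerUniGL (fun i => (x i : ℂ))) v = v) (x : Fin N → ℤ) (s : ℂ) :
    ρ (lowerUniGL (fun i => s * (x i : ℂ))) v = v := by
  rw [← sub_eq_zero, ← Module.forall_dual_apply_eq_zero_iff ℂ]
  intro φ
  obtain ⟨P, e, hP⟩ := hρ v φ
  -- The matrix coefficient along the line `s ↦ s x`. Unipotent matrices have determinant `1`, so no
  -- denominator occurs and the coefficient is a polynomial in `s`.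
  set q : Polynomial ℂ := MvPolynomial.aeval
    (fun ij : Fin (N + 1) × Fin (N + 1) =>
      lowerUni (fun i => Polynomial.X * Polynomial.C (x i : ℂ)) ij.1 ij.2) P with hq
  have hqe : ∀ t : ℂ, q.eval t = φ (ρ (lowerUniGL (fun i => t * (x i : ℂ))) v) := by
    intro t
    have h1 := hP (lowerUniGL (fun i => t * (x i : ℂ)))
    have h2 : ((lowerUniGL (fun i => t * (x i : ℂ)) : GeneralLinearGroup (Fin (N + 1)) ℂ) :
      Matrix (Fin (N + 1)) (Fin (N + 1)) ℂ) = lowerUni (fun i => t * (x i : ℂ)) := rfl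
    rw [h2, det_lowerUni, one_pow, mul_one] at h1
    rw [h1, hq, ← Polynomial.coe_evalRingHom, MvPolynomial.aeval_def, MvPolynomial.hom_eval₂]
    rw [MvPolynomial.eval, MvPolynomial.coe_eval₂Hom]
    congr 1
    · ext; simp
    · funext ij
      obtain ⟨i, j⟩ := ij
      refine Fin.cases ?_ (fun i => ?_) i <;> refine Fin.cases ?_ (fun j => ?_) j <;>
        simp [lowerUni, Matrix.one_apply, apply_ite]
  -- At a natural number `k` the point `k x` is again integral, so `q` takes the value `φ v`
  -- infinitely often.
  have hconst : q = Polynomial.C (φ v) := by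
    refine Polynomial.eq_of_infinite_eval_eq _ _ ?_
    refine Set.Infinite.mono ?_ (Set.infinite_range_of_injective (Nat.cast_injective (R := ℂ)))
    rintro _ ⟨k, rfl⟩
    have := hv (fun i => k * x i)
    push_cast at this
    simp only [Set.mem_ofPred_eq, hqe, this, Polynomial.eval_C]
  have := hqe s
  rw [hconst, Polynomial.eval_C] at this
  rw [map_sub, ← this, sub_self]

/-- The symplectic matrix `(ᵗU⁻¹, 0; 0, U)`. -/
def glEmbed {n : ℕ} (U : GeneralLinearGroup (Fin n) ℤ) : symplecticGroup (Fin n) ℤ :=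
  ⟨fromBlocks (U⁻¹).1ᵀ 0 0 U.1, by
    have h1 : (U⁻¹).1 * U.1 = 1 := U.inv_mul
    have h2 : U.1ᵀ * (U⁻¹).1ᵀ = 1 := by rw [← Matrix.transpose_mul, h1, Matrix.transpose_one]
    rw [SymplecticGroup.mem_iff']
    generalize (U⁻¹).1 = W at h1 h2 ⊢
    simp [J, fromBlocks_transpose, fromBlocks_multiply, h1, h2]⟩

theorem isSimilitude_of_mem {n : ℕ} (γ : symplecticGroup (Fin n) ℤ) : IsSimilitude 1 γ.1 := by
  have := SymplecticGroup.mem_iff'.1 γ.2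
  simpa [IsSimilitude] using this

/-- The limit of a Jacobi form is fixed by the unipotent matrices with integral entries. -/
theorem IsJacobiForm.apply_lowerUniGL_of_int {N m : ℕ} {V : Type*} [NormedAddCommGroup V]
    [NormedSpace ℂ V] [FiniteDimensional ℂ V] {𝓜 : Matrix (Fin m) (Fin m) ℝ}
    {ρ : Representation ℂ (GeneralLinearGroup (Fin (N + 1)) ℂ) V}
    {f : Matrix (Fin (N + 1)) (Fin (N + 1)) ℂ → Matrix (Fin m) (Fin (N + 1)) ℂ → V}
    (hf : IsJacobiForm ρ 𝓜 ⊤ f) {G : Matrix (Fin N) (Fin N) ℂ → Matrix (Fin m) (Fin N) ℂ → V}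
    (hG : ∀ X ∈ siegelH (N + 1), ∀ Z : Matrix (Fin m) (Fin (N + 1)) ℂ,
      Tendsto (fun t : ℝ => f (X + Matrix.single 0 0 (Complex.I * t)) Z) atTop
        (𝓝 (G (X.submatrix Fin.succ Fin.succ) (Z.submatrix id Fin.succ))))
    {Ω : Matrix (Fin N) (Fin N) ℂ} (hΩ : Ω ∈ siegelH N) (Z : Matrix (Fin m) (Fin N) ℂ)
    (x : Fin N → ℤ) : ρ (lowerUniGL (fun i => (x i : ℂ))) (G Ω Z) = G Ω Z := by
  -- The sign is chosen so that `ρ(D)⁻¹` is the operator of the unipotent matrix with column `x`.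
  -- Deleting the first indices from this `γ` leaves the identity, so `G` is evaluated at `(Ω, Z)`
  -- itself.
  set γ : symplecticGroup (Fin (N + 1)) ℤ := glEmbed (lowerUniGL (-x)) with hγ
  have hval : γ.1 = fromBlocks (lowerUni x)ᵀ 0 0 (lowerUni (-x)) := by
    have : ((lowerUniGL (-x))⁻¹ : GeneralLinearGroup (Fin (N + 1)) ℤ).1 = lowerUni x := by
      change lowerUni (- -x) = _
      rw [neg_neg]
    change fromBlocks (((lowerUniGL (-x))⁻¹ : GeneralLinearGroup (Fin (N + 1)) ℤ).1)ᵀ 0 0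
      (lowerUni (-x)) = _
    rw [this]
  have hr : IsReduced γ.1 := by
    rw [hval]
    constructor <;> simp [lowerUni]
  have hstar : starMat γ.1 = 1 := by
    rw [hval, ← fromBlocks_one, starMat]
    congr 1 <;> (ext i j; simp [lowerUni, Matrix.one_apply, eq_comm])
  have hA : blkA (starMat γ.1) = 1 := by
    rw [hstar]; ext i j; simp [blkA, Matrix.one_apply, toBlocks₁₁]
  have hD : blkD (starMat γ.1) = 1 := by
    rw [hstar]; ext i j; simp [blkD, Matrix.one_apply, toBlocks₂₂]
  have hB : blkB (starMat γ.1) = 0 := by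
    rw [hstar]; ext i j; simp [blkB, toBlocks₁₂]
  have h1 := hr.tendsto_siegelPath_slash ρ 𝓜 (isSimilitude_of_mem γ) one_ne_zero hG hΩ Z
  rw [hA, hB, hD] at h1
  simp only [Matrix.one_mul, add_zero, inv_one, Matrix.mul_one, Nat.cast_one, one_smul] at h1
  -- By invariance `f|γ` is `f` on the path, so the same function has the two limits to be compared.
  have h2 : Tendsto (siegelPath (slash ρ 𝓜 1 γ.1 0 0 0 f) Ω Z) atTop (𝓝 (G Ω Z)) := by
    refine (tendsto_siegelPath hG hΩ Z).congr' ?_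
    filter_upwards [eventually_gt_atTop 0] with t ht
    exact (hf.invariant γ trivial 0 0 0 (by simp [Matrix.IsSymm]) _
      (diagBlock_mem_siegelH hΩ ht) _).symm
  have h3 := tendsto_nhds_unique h1 h2
  have h4 : blkD γ.1 = ((lowerUniGL (fun i => (x i : ℂ)))⁻¹ :
      GeneralLinearGroup (Fin (N + 1)) ℂ).1 := by
    change blkD γ.1 = lowerUni _
    rw [hval]
    ext i j
    refine Fin.cases ?_ (fun i => ?_) i <;> refine Fin.cases ?_ (fun j => ?_) j <;>
      simp [blkD, lowerUni, Matrix.one_apply, apply_ite]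
  rw [h4, repInv_coe, inv_inv] at h3
  exact h3

/-! ### The embedding of `Γ_N` into `Γ_{N+1}` -/

/-- The block diagonal matrix `(w, 0; 0, X)`. -/
def bordered {N : ℕ} {K : Type*} [CommRing K] (w : K) (X : Matrix (Fin N) (Fin N) K) :
    Matrix (Fin (N + 1)) (Fin (N + 1)) K :=
  Matrix.of (Fin.cons (Fin.cons w 0) (fun i => Fin.cons 0 (X i)))

section Bordered

variable {N : ℕ} {K : Type*} [CommRing K] (w w' : K) (X X' : Matrix (Fin N) (Fin N) K)

theorem bordered_mul : bordered w X * bordered w' X' = bordered (w * w') (X * X') := by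
  ext i j
  refine Fin.cases ?_ (fun i => ?_) i <;> refine Fin.cases ?_ (fun j => ?_) j <;>
    simp [bordered, Matrix.mul_apply, Fin.sum_univ_succ]

theorem bordered_add : bordered w X + bordered w' X' = bordered (w + w') (X + X') := by
  ext i j
  refine Fin.cases ?_ (fun i => ?_) i <;> refine Fin.cases ?_ (fun j => ?_) j <;>
    simp [bordered]

theorem bordered_neg : -bordered w X = bordered (-w) (-X) := by
  ext i j
  refine Fin.cases ?_ (fun i => ?_) i <;> refine Fin.cases ?_ (fun j => ?_) j <;>
    simp [bordered]

theorem bordered_transpose : (bordered w X)ᵀ = bordered w Xᵀ := by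
  ext i j
  refine Fin.cases ?_ (fun i => ?_) i <;> refine Fin.cases ?_ (fun j => ?_) j <;>
    simp [bordered]

theorem bordered_zero_zero : bordered (0 : K) (0 : Matrix (Fin N) (Fin N) K) = 0 := by
  ext i j
  refine Fin.cases ?_ (fun i => ?_) i <;> refine Fin.cases ?_ (fun j => ?_) j <;>
    simp [bordered]

theorem bordered_one_one : bordered (1 : K) (1 : Matrix (Fin N) (Fin N) K) = 1 := by
  ext i j
  refine Fin.cases ?_ (fun i => ?_) i <;> refine Fin.cases ?_ (fun j => ?_) j <;>
    simp [bordered, Matrix.one_apply, (Fin.succ_ne_zero _).symm]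

theorem bordered_map {L : Type*} [CommRing L] (φ : K →+* L) :
    (bordered w X).map φ = bordered (φ w) (X.map φ) := by
  ext i j
  refine Fin.cases ?_ (fun i => ?_) i <;> refine Fin.cases ?_ (fun j => ?_) j <;>
    simp [bordered]

end Bordered

/-- The image `(1, 0; 0, γ)` of a matrix of degree `2N` in degree `2(N + 1)`. -/
def upMat {N : ℕ} (γ : Matrix (Fin N ⊕ Fin N) (Fin N ⊕ Fin N) ℤ) :
    Matrix (Fin (N + 1) ⊕ Fin (N + 1)) (Fin (N + 1) ⊕ Fin (N + 1)) ℤ :=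
  fromBlocks (bordered 1 γ.toBlocks₁₁) (bordered 0 γ.toBlocks₁₂)
    (bordered 0 γ.toBlocks₂₁) (bordered 1 γ.toBlocks₂₂)

theorem upMat_mem {N : ℕ} {γ : Matrix (Fin N ⊕ Fin N) (Fin N ⊕ Fin N) ℤ}
    (h : γ ∈ symplecticGroup (Fin N) ℤ) : upMat γ ∈ symplecticGroup (Fin (N + 1)) ℤ := by
  rw [SymplecticGroup.mem_iff'] at h ⊢
  rw [← Matrix.fromBlocks_toBlocks γ] at h
  unfold upMat
  generalize γ.toBlocks₁₁ = A at *
  generalize γ.toBlocks₁₂ = B at *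
  generalize γ.toBlocks₂₁ = C at *
  generalize γ.toBlocks₂₂ = D at *
  have hJ : J (Fin (N + 1)) ℤ =
      fromBlocks (bordered 0 0) (-bordered 1 1) (bordered 1 1) (bordered 0 0) := by
    rw [bordered_one_one, bordered_zero_zero]
    rfl
  rw [hJ]
  simp only [J, fromBlocks_transpose, fromBlocks_multiply, fromBlocks_inj, bordered_mul,
    bordered_add, bordered_transpose, bordered_neg] at h ⊢
  obtain ⟨h1, h2, h3, h4⟩ := h
  rw [h1, h2, h3, h4]
  simp

/-- The embedding `Γ_N → Γ_{N+1}`. -/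
def upSp {N : ℕ} (γ : symplecticGroup (Fin N) ℤ) : symplecticGroup (Fin (N + 1)) ℤ :=
  ⟨upMat γ.1, upMat_mem γ.2⟩

section Up

variable {N : ℕ} (γ : Matrix (Fin N ⊕ Fin N) (Fin N ⊕ Fin N) ℤ)

theorem blkA_upMat : blkA (upMat γ) = diagBlock 1 (blkA γ) := by
  have := bordered_map 1 γ.toBlocks₁₁ (Int.castRingHom ℂ)
  rw [map_one] at this
  simp only [blkA, upMat, toBlocks_fromBlocks₁₁]
  exact this

theorem blkB_upMat : blkB (upMat γ) = diagBlock 0 (blkB γ) := by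
  have := bordered_map 0 γ.toBlocks₁₂ (Int.castRingHom ℂ)
  rw [map_zero] at this
  simp only [blkB, upMat, toBlocks_fromBlocks₁₂]
  exact this

theorem blkC_upMat : blkC (upMat γ) = diagBlock 0 (blkC γ) := by
  have := bordered_map 0 γ.toBlocks₂₁ (Int.castRingHom ℂ)
  rw [map_zero] at this
  simp only [blkC, upMat, toBlocks_fromBlocks₂₁]
  exact this

theorem blkD_upMat : blkD (upMat γ) = diagBlock 1 (blkD γ) := by
  have := bordered_map 1 γ.toBlocks₂₂ (Int.castRingHom ℂ)
  rw [map_one] at this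
  simp only [blkD, upMat, toBlocks_fromBlocks₂₂]
  exact this

end Up

theorem diagBlock_add {N : ℕ} (w w' : ℂ) (X X' : Matrix (Fin N) (Fin N) ℂ) :
    diagBlock w X + diagBlock w' X' = diagBlock (w + w') (X + X') := bordered_add w w' X X'

theorem det_diagBlock {N : ℕ} (w : ℂ) (X : Matrix (Fin N) (Fin N) ℂ) :
    (diagBlock w X).det = w * X.det := by
  rw [Matrix.det_succ_row_zero, Fin.sum_univ_succ]
  have h : (diagBlock w X).submatrix Fin.succ Fin.succ = X := diagBlock_submatrix w X
  simp [diagBlock] at h ⊢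
  exact Or.inl (by rw [h])

theorem zeroCol_mul {N m : ℕ} (Z : Matrix (Fin m) (Fin N) ℂ) (w : ℂ)
    (X : Matrix (Fin N) (Fin N) ℂ) : zeroCol Z * diagBlock w X = zeroCol (Z * X) := by
  ext i j
  refine Fin.cases ?_ (fun j => ?_) j <;>
    simp [zeroCol, diagBlock, Matrix.mul_apply, Fin.sum_univ_succ]

theorem mul_zeroCol {N m l : ℕ} (Y : Matrix (Fin l) (Fin m) ℂ) (Z : Matrix (Fin m) (Fin N) ℂ) :
    Y * zeroCol Z = zeroCol (Y * Z) := by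
  ext i j
  refine Fin.cases ?_ (fun j => ?_) j <;> simp [zeroCol, Matrix.mul_apply]

theorem zeroCol_mul_transpose {N m l : ℕ} (Y : Matrix (Fin l) (Fin N) ℂ)
    (Z : Matrix (Fin m) (Fin N) ℂ) : zeroCol Y * (zeroCol Z)ᵀ = Y * Zᵀ := by
  ext i j
  simp [zeroCol, Matrix.mul_apply, Fin.sum_univ_succ]

/-! ### The map `R`: automorphy factors and invariance of the limit -/

section Intertwiner

variable {N m : ℕ} {V V₀ : Type*} [NormedAddCommGroup V] [NormedSpace ℂ V]
  [FiniteDimensional ℂ V] [NormedAddCommGroup V₀] [NormedSpace ℂ V₀]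
  {𝓜 : Matrix (Fin m) (Fin m) ℝ}
  {ρ : Representation ℂ (GeneralLinearGroup (Fin (N + 1)) ℂ) V}
  {ρ₀ : Representation ℂ (GeneralLinearGroup (Fin N) ℂ) V₀} {R : V →ₗ[ℂ] V₀} {k : ℤ}
  {f : Matrix (Fin (N + 1)) (Fin (N + 1)) ℂ → Matrix (Fin m) (Fin (N + 1)) ℂ → V}
  {G : Matrix (Fin N) (Fin N) ℂ → Matrix (Fin m) (Fin N) ℂ → V}

omit [FiniteDimensional ℂ V] in
theorem intertwiner_diagGL
    (h1 : ∀ A : GeneralLinearGroup (Fin N) ℂ, R ∘ₗ ρ (diagGL 1 A) = ρ₀ A ∘ₗ R)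
    (h2 : ∀ a : ℂˣ, R ∘ₗ ρ (diagGL a 1) = ((a : ℂ) ^ k) • R)
    (a : ℂˣ) (A : GeneralLinearGroup (Fin N) ℂ) (v : V) :
    R (ρ (diagGL a A)⁻¹ v) = ((a : ℂ) ^ (-k)) • ρ₀ A⁻¹ (R v) := by
  have hmul : diagGL a A = diagGL a 1 * diagGL 1 A := by
    apply Units.ext
    change diagBlock _ _ = diagBlock _ _ * diagBlock _ _
    rw [diagBlock_mul]
    simp
  have key : R v = ((a : ℂ) ^ k) • ρ₀ A (R (ρ (diagGL a A)⁻¹ v)) := by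
    have e1 : v = ρ (diagGL a 1) (ρ (diagGL 1 A) (ρ (diagGL a A)⁻¹ v)) := by
      rw [← Module.End.mul_apply, ← Module.End.mul_apply, ← map_mul, ← map_mul, ← hmul,
        mul_inv_cancel, map_one, Module.End.one_apply]
    conv_lhs => rw [e1]
    have e2 := LinearMap.congr_fun (h2 a) (ρ (diagGL 1 A) (ρ (diagGL a A)⁻¹ v))
    have e3 := LinearMap.congr_fun (h1 A) (ρ (diagGL a A)⁻¹ v)
    simp only [LinearMap.comp_apply, LinearMap.smul_apply] at e2 e3
    rw [e2, e3]
  rw [key, map_smul, smul_smul, ← zpow_add₀ a.ne_zero, neg_add_cancel, zpow_zero, one_smul,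
    ← Module.End.mul_apply, ← map_mul, inv_mul_cancel, map_one, Module.End.one_apply]

-- The factorization `D = u · diag(d, D*)`, with `u` unipotent of column `δ/d`, turns `ρ(D)⁻¹` into
-- `ρ(diag(d, D*))⁻¹ ρ(u)⁻¹`. The vector is fixed by `u`, and `R` intertwines the diagonal part at
-- the cost of `d^(-k)`.
omit [FiniteDimensional ℂ V] in
theorem IsReduced.intertwiner_repInv
    {M : Matrix (Fin (N + 1) ⊕ Fin (N + 1)) (Fin (N + 1) ⊕ Fin (N + 1)) ℤ} (hr : IsReduced M)
    {ℓ : ℕ} (h : IsSimilitude ℓ M) (hℓ : ℓ ≠ 0)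
    (h1 : ∀ A : GeneralLinearGroup (Fin N) ℂ, R ∘ₗ ρ (diagGL 1 A) = ρ₀ A ∘ₗ R)
    (h2 : ∀ a : ℂˣ, R ∘ₗ ρ (diagGL a 1) = ((a : ℂ) ^ k) • R) {v : V}
    (hv : ∀ (x : Fin N → ℤ) (s : ℂ), ρ (lowerUniGL (fun i => s * (x i : ℂ))) v = v) :
    R (repInv ρ (blkD M) v) =
      (((M.toBlocks₂₂ 0 0 : ℤ) : ℂ) ^ (-k)) • repInv ρ₀ (blkD (starMat M)) (R v) := by
  obtain ⟨D', hD'⟩ := (isSimilitude_starMat hr h).isUnit_blkD starMat_toBlocks₂₁ hℓ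
  have hd : ((M.toBlocks₂₂ 0 0 : ℤ) : ℂ) ≠ 0 := by exact_mod_cast hr.d_pos.ne'
  set d : ℂˣ := Units.mk0 _ hd with hd'
  set u := lowerUniGL (fun i : Fin N => (d : ℂ)⁻¹ * ((M.toBlocks₂₂ i.succ 0 : ℤ) : ℂ)) with hu
  have hfac : blkD M = (u : Matrix (Fin (N + 1)) (Fin (N + 1)) ℂ) *
      (diagGL d D' : Matrix (Fin (N + 1)) (Fin (N + 1)) ℂ) := by
    change blkD M = lowerUni _ * diagBlock _ (D' : Matrix (Fin N) (Fin N) ℂ)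
    rw [hD', blkD_starMat]
    ext i j
    refine Fin.cases ?_ (fun i => ?_) i <;> refine Fin.cases ?_ (fun j => ?_) j
    · simp [lowerUni, diagBlock, Matrix.mul_apply, Fin.sum_univ_succ, blkD, hd']
    · simp [lowerUni, diagBlock, Matrix.mul_apply, Fin.sum_univ_succ, hr.blkD_row]
    · simp [lowerUni, diagBlock, Matrix.mul_apply, Fin.sum_univ_succ, blkD]
      rw [mul_right_comm, hd', Units.val_mk0, inv_mul_cancel₀ hd, one_mul]
    · simp [lowerUni, diagBlock, Matrix.mul_apply, Fin.sum_univ_succ, Matrix.one_apply]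
  have huv : ρ u⁻¹ v = v := by
    conv_lhs => rw [← hv (fun i => M.toBlocks₂₂ i.succ 0) (d : ℂ)⁻¹]
    rw [← Module.End.mul_apply, ← map_mul, inv_mul_cancel, map_one, Module.End.one_apply]
  rw [hfac, repInv_mul _ _ (Units.isUnit _), repInv_coe, repInv_coe, huv,
    intertwiner_diagGL h1 h2, ← hD', repInv_coe]
  rfl

/-- The function `R ∘ Ψ⁰ f` is invariant under `Γ_N`. -/
theorem IsJacobiForm.slash_intertwiner_siegelJacobi (hf : IsJacobiForm ρ 𝓜 ⊤ f)
    (hlim : ∀ Ω ∈ siegelH N, ∀ Z : Matrix (Fin m) (Fin N) ℂ,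
      Tendsto (siegelPath f Ω Z) atTop (𝓝 (siegelJacobi f Ω Z)))
    (h1 : ∀ A : GeneralLinearGroup (Fin N) ℂ, R ∘ₗ ρ (diagGL 1 A) = ρ₀ A ∘ₗ R)
    (γ : symplecticGroup (Fin N) ℤ) {Ω : Matrix (Fin N) (Fin N) ℂ} (hΩ : Ω ∈ siegelH N)
    (Z : Matrix (Fin m) (Fin N) ℂ) :
    slash ρ₀ 𝓜 1 γ.1 0 0 0 (fun Ω' Z' => R (siegelJacobi f Ω' Z')) Ω Z =
      R (siegelJacobi f Ω Z) := by
  have hinv : ∀ t : ℝ, 0 < t → siegelPath f Ω Z t =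
      siegelPath (slash ρ 𝓜 1 (upMat γ.1) 0 0 0 f) Ω Z t := fun t ht =>
    (hf.invariant (upSp γ) trivial 0 0 0 (by simp [Matrix.IsSymm]) _
      (diagBlock_mem_siegelH hΩ ht) _).symm
  rw [slash_zero]
  have hj : ∀ t : ℝ, blkC (upMat γ.1) * diagBlock (Complex.I * t) Ω + blkD (upMat γ.1) =
      diagBlock 1 (blkC γ.1 * Ω + blkD γ.1) := by
    intro t
    rw [blkC_upMat, blkD_upMat, diagBlock_mul, diagBlock_add, zero_mul, zero_add]
  set j := blkC γ.1 * Ω + blkD γ.1 with hjdef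
  -- Invertibility of `j` is not established for general `γ`; in the singular case both sides
  -- vanish.
  by_cases hju : IsUnit j
  · obtain ⟨g, hg⟩ := hju
    have hginv : ((diagGL 1 g : GeneralLinearGroup (Fin (N + 1)) ℂ) :
        Matrix (Fin (N + 1)) (Fin (N + 1)) ℂ)⁻¹ = diagBlock 1 j⁻¹ := by
      rw [← Matrix.coe_units_inv, ← hg, ← Matrix.coe_units_inv]
      change diagBlock ((1⁻¹ : ℂˣ) : ℂ) _ = _
      simp
    have hgj : diagBlock 1 j = ((diagGL 1 g : GeneralLinearGroup (Fin (N + 1)) ℂ) :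
        Matrix (Fin (N + 1)) (Fin (N + 1)) ℂ) := by
      rw [← hg]; rfl
    set e := Complex.exp (-(2 * Real.pi * Complex.I * ((1 : ℕ) : ℂ) *
      (𝓜.map (fun a => (a : ℂ)) * Z * j⁻¹ * blkC γ.1 * Zᵀ).trace)) with he
    have he0 : e ≠ 0 := Complex.exp_ne_zero _
    set Ω' := (blkA γ.1 * Ω + blkB γ.1) * j⁻¹ with hΩ'
    have hpath : ∀ t : ℝ, siegelPath (slash ρ 𝓜 1 (upMat γ.1) 0 0 0 f) Ω Z t =
        e • ρ (diagGL 1 g)⁻¹ (siegelPath f Ω' (((1 : ℕ) : ℂ) • (Z * j⁻¹)) t) := by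
      intro t
      simp only [siegelPath]
      rw [slash_zero, hj, hgj, hginv, repInv_coe, blkA_upMat, blkB_upMat, blkC_upMat,
        diagBlock_mul, diagBlock_add, diagBlock_mul, mul_zeroCol, zeroCol_mul, zeroCol_mul,
        zeroCol_mul, zeroCol_mul_transpose]
      simp only [one_mul, add_zero, mul_one, Nat.cast_one, one_smul]
      rw [he, Nat.cast_one, mul_one]
    -- The point `γΩ` is not known to lie in `ℍ_N`, so the limit there is obtained by solving the
    -- invariance relation for `f` on the transformed path.
    have hlim' : Tendsto (siegelPath f Ω' (((1 : ℕ) : ℂ) • (Z * j⁻¹))) atTop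
        (𝓝 (e⁻¹ • ρ (diagGL 1 g) (siegelJacobi f Ω Z))) := by
      have hc : Continuous (fun v : V => e⁻¹ • ρ (diagGL 1 g) v) :=
        (LinearMap.continuous_of_finiteDimensional (ρ (diagGL 1 g))).const_smul _
      refine ((hc.tendsto _).comp (hlim Ω hΩ Z)).congr' ?_
      filter_upwards [eventually_gt_atTop 0] with t ht
      rw [Function.comp, hinv t ht, hpath, map_smul, smul_smul, inv_mul_cancel₀ he0, one_smul,
        ← Module.End.mul_apply, ← map_mul, mul_inv_cancel, map_one, Module.End.one_apply]
    have hval : siegelJacobi f Ω' (((1 : ℕ) : ℂ) • (Z * j⁻¹)) =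
        e⁻¹ • ρ (diagGL 1 g) (siegelJacobi f Ω Z) := hlim'.limUnder_eq
    have h3 := LinearMap.congr_fun (h1 g) (siegelJacobi f Ω Z)
    simp only [LinearMap.comp_apply] at h3
    rw [hval, ← hg, repInv_coe, map_smul, h3, map_smul, smul_smul, mul_inv_cancel₀ he0, one_smul,
      ← Module.End.mul_apply, ← map_mul, inv_mul_cancel, map_one, Module.End.one_apply]
  · have hju' : ¬IsUnit (diagBlock 1 j) := by
      rw [Matrix.isUnit_iff_isUnit_det, det_diagBlock, one_mul, ← Matrix.isUnit_iff_isUnit_det]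
      exact hju
    -- Singular automorphy factor: the slash takes its default value `0`, and invariance then forces
    -- `f` to vanish along the path.
    have h0 : siegelJacobi f Ω Z = 0 := by
      refine tendsto_nhds_unique (hlim Ω hΩ Z) (tendsto_const_nhds.congr' ?_)
      filter_upwards [eventually_gt_atTop 0] with t ht
      rw [hinv t ht, siegelPath, slash_zero, hj, repInv_of_not_isUnit ρ hju', smul_zero]
    rw [repInv_of_not_isUnit ρ₀ hju, smul_zero, h0, map_zero]

end Intertwiner

/-! ### Transitivity of `Γₙ` on lines spanned by integral vectors -/

/-- Dividing by the gcd gives a primitive vector `(x', y')`; the row `(-y', x')` annihilates it and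
is completed to determinant `1` by Bézout. -/
theorem exists_SL2_mulVec (x y : ℤ) :
    ∃ a b c d : ℤ, a * d - b * c = 1 ∧ c * x + d * y = 0 := by
  rcases Nat.eq_zero_or_pos (Int.gcd x y) with h | h
  · obtain ⟨rfl, rfl⟩ := Int.gcd_eq_zero_iff.1 h
    exact ⟨1, 0, 0, 1, by norm_num, by norm_num⟩
  · obtain ⟨x', y', hg, hx, hy⟩ := Int.exists_gcd_one h
    obtain ⟨u, w, huw⟩ := Int.isCoprime_iff_gcd_eq_one.2 hg
    refine ⟨u, w, -y', x', by linarith, ?_⟩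
    linear_combination (-y') * hx + x' * hy

/-- Smith normal form for the submodule spanned by `x` yields a basis of the lattice with `x` a
multiple of one member. Passing to coordinates in that basis, reindexed so that this member is
first, is the required matrix. -/
theorem exists_GL_mulVec {N : ℕ} (x : Fin (N + 1) → ℤ) :
    ∃ U U' : Matrix (Fin (N + 1)) (Fin (N + 1)) ℤ, U * U' = 1 ∧ U' * U = 1 ∧
      ∃ g : ℤ, U *ᵥ x = Pi.single 0 g := by
  by_cases hx : x = 0
  · exact ⟨1, 1, by simp, by simp, 0, by simp [hx]⟩
  obtain ⟨b, c, i, hb⟩ : ∃ (b : Module.Basis (Fin (N + 1)) ℤ (Fin (N + 1) → ℤ)) (c : ℤ)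
      (i : Fin (N + 1)), x = c • b i := by
    obtain ⟨n, bM, bN, φ, a, snf⟩ :=
      Submodule.smithNormalForm (Pi.basisFun ℤ (Fin (N + 1))) (Submodule.span ℤ {x})
    have hn : n = 1 := by
      have h1 := (LinearEquiv.toSpanNonzeroSingleton ℤ (Fin (N + 1) → ℤ) x hx).finrank_eq
      rw [Module.finrank_self, Module.finrank_eq_card_basis bN, Fintype.card_fin] at h1
      exact h1.symm
    subst hn
    have h2 := congrArg Subtype.val
      (bN.sum_repr ⟨x, Submodule.mem_span_singleton_self x⟩)
    refine ⟨bM, bN.repr ⟨x, Submodule.mem_span_singleton_self x⟩ 0 * a 0, φ 0, ?_⟩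
    rw [mul_smul, ← snf]
    simpa using h2.symm
  set e : (Fin (N + 1) → ℤ) ≃ₗ[ℤ] (Fin (N + 1) → ℤ) :=
    (b.reindex (Equiv.swap i 0)).equivFun with he
  refine ⟨LinearMap.toMatrix' e.toLinearMap, LinearMap.toMatrix' e.symm.toLinearMap, ?_, ?_, c, ?_⟩
  · rw [← LinearMap.toMatrix'_comp, LinearEquiv.comp_coe, LinearEquiv.symm_trans_self]
    exact LinearMap.toMatrix'_id
  · rw [← LinearMap.toMatrix'_comp, LinearEquiv.comp_coe, LinearEquiv.self_trans_symm]
    exact LinearMap.toMatrix'_id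
  · rw [LinearMap.toMatrix'_mulVec, hb]
    have h3 : b i = (b.reindex (Equiv.swap i 0)) 0 := by simp
    have h4 : e (b i) = Pi.single 0 1 := by
      rw [h3, he]
      ext j
      simp [Pi.single_apply, Finsupp.single_apply, eq_comm]
    rw [LinearEquiv.coe_coe, map_smul, h4, ← Pi.single_smul, smul_eq_mul, mul_one]

/-- Each of the `n` coordinate planes is symplectic, and a separate element of `SL₂(ℤ)` may act on
each. -/
theorem fromBlocks_diagonal_mem {n : ℕ} {a b c d : Fin n → ℤ}
    (h : ∀ i, a i * d i - b i * c i = 1) :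
    fromBlocks (diagonal a) (diagonal b) (diagonal c) (diagonal d) ∈ symplecticGroup (Fin n) ℤ := by
  rw [SymplecticGroup.mem_iff']
  have hJ : J (Fin n) ℤ = fromBlocks (diagonal fun _ => 0) (diagonal fun _ => -1)
      (diagonal fun _ => 1) (diagonal fun _ => 0) := by
    simp [J, ← diagonal_neg]
  rw [hJ]
  simp only [fromBlocks_transpose, fromBlocks_multiply, diagonal_transpose, diagonal_mul_diagonal,
    diagonal_add]
  congr 1 <;> congr 1 <;> funext i <;> linarith [h i]

/-- Every integral vector can be moved to the line spanned by the first vector of the standard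
basis. -/
theorem exists_symplectic_mulVec {N : ℕ} (v : Fin (N + 1) ⊕ Fin (N + 1) → ℤ) :
    ∃ (γ : symplecticGroup (Fin (N + 1)) ℤ) (g : ℤ), γ.1 *ᵥ v = Pi.single (Sum.inl 0) g := by
  -- First one copy of `SL₂(ℤ)` per plane clears the lower half of the vector; then a matrix of `GL`
  -- reduces the upper half to one entry.
  choose a b c d h hcd using fun i : Fin (N + 1) => exists_SL2_mulVec (v (Sum.inl i)) (v (Sum.inr i))
  set γ₁ : symplecticGroup (Fin (N + 1)) ℤ := ⟨_, fromBlocks_diagonal_mem h⟩ with hγ₁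
  set x : Fin (N + 1) → ℤ := fun i => a i * v (Sum.inl i) + b i * v (Sum.inr i) with hx
  have h1 : γ₁.1 *ᵥ v = Sum.elim x 0 := by
    rw [hγ₁, fromBlocks_mulVec]
    congr 1
    · ext i; simp [hx, mulVec_diagonal]
    · ext i; simpa [mulVec_diagonal] using hcd i
  obtain ⟨U, U', hU, hU', g, hg⟩ := exists_GL_mulVec x
  have hU₁ : U'ᵀ * Uᵀ = 1 := by rw [← Matrix.transpose_mul, hU, Matrix.transpose_one]
  have hU₂ : Uᵀ * U'ᵀ = 1 := by rw [← Matrix.transpose_mul, hU', Matrix.transpose_one]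
  -- `glEmbed` puts the inverse transpose into the upper block, so it is fed `ᵗU'` in order to act
  -- on the upper half by `U`.
  refine ⟨glEmbed ⟨U'ᵀ, Uᵀ, hU₁, hU₂⟩ * γ₁, g, ?_⟩
  rw [Submonoid.coe_mul, ← Matrix.mulVec_mulVec, h1]
  change fromBlocks Uᵀᵀ 0 0 U'ᵀ *ᵥ _ = _
  rw [fromBlocks_mulVec]
  ext i
  rcases i with i | i
  · simp [hg, Pi.single_apply]
  · simp

/-! ### The parabolic shape and the existence of reduced representatives -/

/-- The shape of a matrix which preserves the line spanned by the first standard basis vector and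
the span of all standard basis vectors but the one paired with it. -/
structure IsKlingen {N : ℕ}
    (M : Matrix (Fin (N + 1) ⊕ Fin (N + 1)) (Fin (N + 1) ⊕ Fin (N + 1)) ℤ) : Prop where
  A_col : ∀ i : Fin N, M (Sum.inl i.succ) (Sum.inl 0) = 0
  C_col : ∀ i : Fin (N + 1), M (Sum.inr i) (Sum.inl 0) = 0
  C_row : ∀ j : Fin (N + 1), M (Sum.inr 0) (Sum.inl j) = 0
  D_row : ∀ j : Fin N, M (Sum.inr 0) (Sum.inr j.succ) = 0

/-- The matrix obtained by deleting the first and the `(N + 2)`-nd row and column. -/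
def downMat {N : ℕ} (M : Matrix (Fin (N + 1) ⊕ Fin (N + 1)) (Fin (N + 1) ⊕ Fin (N + 1)) ℤ) :
    Matrix (Fin N ⊕ Fin N) (Fin N ⊕ Fin N) ℤ :=
  M.submatrix (Sum.map Fin.succ Fin.succ) (Sum.map Fin.succ Fin.succ)

theorem IsSimilitude.mul {n ℓ ℓ' : ℕ} {M M' : Matrix (Fin n ⊕ Fin n) (Fin n ⊕ Fin n) ℤ}
    (h : IsSimilitude ℓ M) (h' : IsSimilitude ℓ' M') : IsSimilitude (ℓ * ℓ') (M * M') := by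
  unfold IsSimilitude at *
  calc (M * M')ᵀ * J (Fin n) ℤ * (M * M') = M'ᵀ * (Mᵀ * J (Fin n) ℤ * M) * M' := by
        simp only [Matrix.transpose_mul, Matrix.mul_assoc]
    _ = _ := by rw [h, Matrix.mul_smul, Matrix.smul_mul, h', smul_smul]; push_cast; rfl

theorem IsSimilitude.symplectic_mul {n ℓ : ℕ} {M : Matrix (Fin n ⊕ Fin n) (Fin n ⊕ Fin n) ℤ}
    (h : IsSimilitude ℓ M) (γ : symplecticGroup (Fin n) ℤ) : IsSimilitude ℓ (γ.1 * M) := by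
  simpa using (isSimilitude_of_mem γ).mul h

theorem IsSimilitude.mul_symplectic {n ℓ : ℕ} {M : Matrix (Fin n ⊕ Fin n) (Fin n ⊕ Fin n) ℤ}
    (h : IsSimilitude ℓ M) (γ : symplecticGroup (Fin n) ℤ) : IsSimilitude ℓ (M * γ.1) := by
  simpa using h.mul (isSimilitude_of_mem γ)

section Klingen

variable {N ℓ : ℕ} {M M' : Matrix (Fin (N + 1) ⊕ Fin (N + 1)) (Fin (N + 1) ⊕ Fin (N + 1)) ℤ}

/-- For a similitude, the condition on the first column implies the one on the row paired
with it. -/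
theorem IsSimilitude.isKlingen (h : IsSimilitude ℓ M) (hℓ : ℓ ≠ 0)
    (hA : ∀ i : Fin N, M (Sum.inl i.succ) (Sum.inl 0) = 0)
    (hC : ∀ i : Fin (N + 1), M (Sum.inr i) (Sum.inl 0) = 0) :
    IsKlingen M ∧ M (Sum.inr 0) (Sum.inr 0) * M (Sum.inl 0) (Sum.inl 0) = ℓ := by
  -- Since `M e = a e`, pairing the `j`-th column of `M` with the first one gives `a` times an entry
  -- of the row paired with `e`; the similitude relation fixes this value.
  have key : ∀ j, M (Sum.inr 0) j * M (Sum.inl 0) (Sum.inl 0) =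
      ℓ * (if j = Sum.inr 0 then 1 else 0) := by
    intro j
    have h1 := congrFun (congrFun h j) (Sum.inl 0)
    rcases j with j | j <;>
      simpa [Matrix.mul_apply, J, Fintype.sum_sum_type, Fin.sum_univ_succ, hA, hC,
        Matrix.one_apply, eq_comm] using h1
  have hdet : M (Sum.inr 0) (Sum.inr 0) * M (Sum.inl 0) (Sum.inl 0) = ℓ := by
    simpa using key (Sum.inr 0)
  have ha : M (Sum.inl 0) (Sum.inl 0) ≠ 0 := by
    intro h0
    rw [h0, mul_zero] at hdet
    exact hℓ (by exact_mod_cast hdet.symm)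
  refine ⟨⟨hA, hC, fun j => ?_, fun j => ?_⟩, hdet⟩
  · exact (mul_eq_zero.1 ((key (Sum.inl j)).trans (by simp))).resolve_right ha
  · exact (mul_eq_zero.1 ((key (Sum.inr j.succ)).trans (by simp))).resolve_right ha

/-- Such matrices preserve the line of `e` and its symplectic complement, and `downMat` is the
induced action on the quotient of the complement by the line; hence it is multiplicative. -/
theorem IsKlingen.downMat_mul (h : IsKlingen M) (h' : IsKlingen M') :
    downMat (M * M') = downMat M * downMat M' := by
  ext i j
  rcases i with i | i <;> rcases j with j | j <;>
    simp [downMat, Matrix.mul_apply, Fintype.sum_sum_type, Fin.sum_univ_succ, h.A_col, h.C_col,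
      h'.C_row, h'.D_row]

theorem IsKlingen.mul_apply_inr (h : IsKlingen M) :
    (M * M') (Sum.inr 0) (Sum.inr 0) = M (Sum.inr 0) (Sum.inr 0) * M' (Sum.inr 0) (Sum.inr 0) := by
  simp [Matrix.mul_apply, Fintype.sum_sum_type, Fin.sum_univ_succ, h.C_row, h.D_row]

theorem IsKlingen.mul (h : IsKlingen M) (h' : IsKlingen M') : IsKlingen (M * M') := by
  constructor <;> intro i <;>
    simp [Matrix.mul_apply, Fintype.sum_sum_type, Fin.sum_univ_succ, h.A_col, h.C_col, h.C_row,
      h.D_row, h'.A_col, h'.C_col, h'.C_row, h'.D_row]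

theorem IsKlingen.isSimilitude_downMat (hk : IsKlingen M) (h : IsSimilitude ℓ M) :
    IsSimilitude ℓ (downMat M) := by
  unfold IsSimilitude at h ⊢
  ext i j
  have h1 := congrFun (congrFun h (Sum.map Fin.succ Fin.succ i)) (Sum.map Fin.succ Fin.succ j)
  rcases i with i | i <;> rcases j with j | j <;>
    simpa [downMat, Matrix.mul_apply, J, Fintype.sum_sum_type, Fin.sum_univ_succ, hk.C_row,
      hk.D_row, Matrix.one_apply, Fin.succ_ne_zero, (Fin.succ_ne_zero _).symm] using h1

theorem downMat_upMat (γ : Matrix (Fin N ⊕ Fin N) (Fin N ⊕ Fin N) ℤ) : downMat (upMat γ) = γ := by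
  ext i j
  rcases i with i | i <;> rcases j with j | j <;>
    simp [downMat, upMat, bordered, toBlocks₁₁, toBlocks₁₂, toBlocks₂₁, toBlocks₂₂]

theorem isKlingen_upMat (γ : Matrix (Fin N ⊕ Fin N) (Fin N ⊕ Fin N) ℤ) : IsKlingen (upMat γ) := by
  constructor <;> intro i <;> (try refine Fin.cases ?_ (fun i => ?_) i) <;> simp [upMat, bordered]

theorem upMat_apply_inr (γ : Matrix (Fin N ⊕ Fin N) (Fin N ⊕ Fin N) ℤ) :
    upMat γ (Sum.inr 0) (Sum.inr 0) = 1 := by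
  simp [upMat, bordered]

theorem IsReduced.isKlingen (hr : IsReduced M) : IsKlingen M where
  A_col := hr.A_col
  C_col i := congrFun (congrFun hr.C_eq i) 0
  C_row j := congrFun (congrFun hr.C_eq 0) j
  D_row := hr.D_row

theorem IsReduced.starMat_eq (hr : IsReduced M) : starMat M = downMat M := by
  ext i j
  rcases i with i | i <;> rcases j with j | j
  · rfl
  · rfl
  · exact (congrFun (congrFun hr.C_eq i.succ) j.succ).symm
  · rfl

theorem IsKlingen.isReduced (hk : IsKlingen M) (hC : (downMat M).toBlocks₂₁ = 0)
    (hd : 0 < M (Sum.inr 0) (Sum.inr 0)) : IsReduced M where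
  C_eq := by
    ext i j
    refine Fin.cases (hk.C_row j) (fun i => ?_) i
    exact Fin.cases (hk.C_col i.succ) (fun j => congrFun (congrFun hC i) j) j
  A_col := hk.A_col
  D_row := hk.D_row
  d_pos := hd

end Klingen

theorem neg_one_mem_symplecticGroup {n : ℕ} :
    (-1 : Matrix (Fin n ⊕ Fin n) (Fin n ⊕ Fin n) ℤ) ∈ symplecticGroup (Fin n) ℤ := by
  rw [SymplecticGroup.mem_iff']
  simp

/-- Inductive step: an element of `Γ_{N+1}` moves the first column to the line of `e`, which forces
the parabolic shape. The lower left block of the smaller similitude is then cleared by an element of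
`Γ_N` embedded through `upSp`. -/
theorem exists_isReduced_of_exists {N : ℕ}
    (ih : ∀ (ℓ : ℕ) (M : Matrix (Fin N ⊕ Fin N) (Fin N ⊕ Fin N) ℤ), IsSimilitude ℓ M → ℓ ≠ 0 →
      ∃ γ : symplecticGroup (Fin N) ℤ, (γ.1 * M).toBlocks₂₁ = 0)
    {ℓ : ℕ} {M : Matrix (Fin (N + 1) ⊕ Fin (N + 1)) (Fin (N + 1) ⊕ Fin (N + 1)) ℤ}
    (h : IsSimilitude ℓ M) (hℓ : ℓ ≠ 0) :
    ∃ γ : symplecticGroup (Fin (N + 1)) ℤ, IsReduced (γ.1 * M) := by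
  obtain ⟨γ₁, g, hg⟩ := exists_symplectic_mulVec (fun i => M i (Sum.inl 0))
  have hcol : ∀ i, (γ₁.1 * M) i (Sum.inl 0) = (Pi.single (Sum.inl 0) g : _ → ℤ) i := fun i => by
    rw [← hg]; rfl
  obtain ⟨hk, had⟩ := (h.symplectic_mul γ₁).isKlingen hℓ (fun i => by rw [hcol]; simp)
    (fun i => by rw [hcol]; simp)
  obtain ⟨γ₂, hγ₂⟩ := ih ℓ _ (hk.isSimilitude_downMat (h.symplectic_mul γ₁)) hℓ
  set M₂ := upMat γ₂.1 * (γ₁.1 * M) with hM₂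
  have hk₂ : IsKlingen M₂ := (isKlingen_upMat _).mul hk
  have hC₂ : (downMat M₂).toBlocks₂₁ = 0 := by
    rw [hM₂, (isKlingen_upMat _).downMat_mul hk, downMat_upMat, hγ₂]
  have hd₂ : M₂ (Sum.inr 0) (Sum.inr 0) ≠ 0 := by
    rw [hM₂, (isKlingen_upMat _).mul_apply_inr, upMat_apply_inr, one_mul]
    intro h0
    rw [h0, zero_mul] at had
    exact hℓ (by exact_mod_cast had.symm)
  -- Multiplication by `-1 ∈ Γ_{N+1}` corrects the sign of `d` without affecting the vanishing
  -- conditions.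
  rcases lt_or_gt_of_ne hd₂ with hneg | hpos
  · refine ⟨⟨_, neg_one_mem_symplecticGroup⟩ * (upSp γ₂ * γ₁), ?_⟩
    have hM : (⟨_, neg_one_mem_symplecticGroup⟩ * (upSp γ₂ * γ₁) :
        symplecticGroup (Fin (N + 1)) ℤ).1 * M = -M₂ := by
      change -1 * (upMat γ₂.1 * γ₁.1) * M = _
      rw [Matrix.neg_mul, Matrix.neg_mul, Matrix.one_mul, Matrix.mul_assoc]
    rw [hM]
    refine IsKlingen.isReduced ⟨?_, ?_, ?_, ?_⟩ ?_ ?_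
    · intro i; simp [hk₂.A_col]
    · intro i; simp [hk₂.C_col]
    · intro i; simp [hk₂.C_row]
    · intro i; simp [hk₂.D_row]
    · ext i j
      have := congrFun (congrFun hC₂ i) j
      simpa [downMat, toBlocks₂₁] using this
    · simpa using hneg
  · refine ⟨upSp γ₂ * γ₁, ?_⟩
    have hM : (upSp γ₂ * γ₁ : symplecticGroup (Fin (N + 1)) ℤ).1 * M = M₂ :=
      Matrix.mul_assoc _ _ _
    rw [hM]
    exact hk₂.isReduced hC₂ hpos

/-- A similitude can be multiplied by an element of `Γₙ` such that the lower left block of the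
product vanishes. -/
theorem exists_toBlocks₂₁_eq_zero (n : ℕ) :
    ∀ (ℓ : ℕ) (M : Matrix (Fin n ⊕ Fin n) (Fin n ⊕ Fin n) ℤ), IsSimilitude ℓ M → ℓ ≠ 0 →
      ∃ γ : symplecticGroup (Fin n) ℤ, (γ.1 * M).toBlocks₂₁ = 0 := by
  induction n with
  | zero => exact fun ℓ M _ _ => ⟨1, by ext i; exact i.elim0⟩
  | succ n ih =>
    intro ℓ M h hℓ
    obtain ⟨γ, hγ⟩ := exists_isReduced_of_exists ih h hℓ
    exact ⟨γ, hγ.C_eq⟩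

theorem IsSimilitude.exists_isReduced {N ℓ : ℕ}
    {M : Matrix (Fin (N + 1) ⊕ Fin (N + 1)) (Fin (N + 1) ⊕ Fin (N + 1)) ℤ}
    (h : IsSimilitude ℓ M) (hℓ : ℓ ≠ 0) :
    ∃ γ : symplecticGroup (Fin (N + 1)) ℤ, IsReduced (γ.1 * M) :=
  exists_isReduced_of_exists (exists_toBlocks₂₁_eq_zero N) h hℓ

/-! ### Multipliers and representatives of left cosets -/

theorem OSet.isSimilitude {n p : ℕ} (M : OSet n p) : IsSimilitude M.mult M.1 := M.2.choose_spec

theorem OSet.mult_ne_zero {n p : ℕ} [Fact p.Prime] (M : OSet n p) : M.mult ≠ 0 :=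
  pow_ne_zero _ (Fact.out : p.Prime).ne_zero

/-- In positive degree `J ≠ 0` determines the multiplier, so `OSet.mult`, which is defined by a
choice, can be compared between representatives. -/
theorem IsSimilitude.unique {n ℓ ℓ' : ℕ} (hn : 0 < n)
    {M : Matrix (Fin n ⊕ Fin n) (Fin n ⊕ Fin n) ℤ} (h : IsSimilitude ℓ M)
    (h' : IsSimilitude ℓ' M) : ℓ = ℓ' := by
  have h1 := congrFun (congrFun (h.symm.trans h') (Sum.inr ⟨0, hn⟩)) (Sum.inl ⟨0, hn⟩)
  have h2 : (ℓ : ℤ) = ℓ' := by simpa [J] using h1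
  exact_mod_cast h2

theorem exists_of_toLeft_eq {n p : ℕ} {M M' : OSet n p} (h : toLeft M = toLeft M') :
    ∃ γ : symplecticGroup (Fin n) ℤ, M'.1 = γ.1 * M.1 := Quotient.exact h

theorem mult_eq_of_toLeft_eq {n p : ℕ} (hn : 0 < n) {M M' : OSet n p}
    (h : toLeft M = toLeft M') : M.mult = M'.mult := by
  obtain ⟨γ, hγ⟩ := exists_of_toLeft_eq h
  have h1 := M.isSimilitude.symplectic_mul γ
  rw [← hγ] at h1
  exact h1.unique hn M'.isSimilitude

/-- For a function invariant under `Γₙ`, the function `f|Γₙ M` can be computed with every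
representative whose lower left block vanishes. -/
theorem slash_out_toLeft {n m p : ℕ} [Fact p.Prime] (hn : 0 < n) {V : Type*} [AddCommGroup V]
    [Module ℂ V] (ρ : Representation ℂ (GeneralLinearGroup (Fin n) ℂ) V)
    (𝓜 : Matrix (Fin m) (Fin m) ℝ) {f : Matrix (Fin n) (Fin n) ℂ → Matrix (Fin m) (Fin n) ℂ → V}
    (hf : ∀ γ : symplecticGroup (Fin n) ℤ, ∀ Ω ∈ siegelH n, ∀ Z : Matrix (Fin m) (Fin n) ℂ,
      slash ρ 𝓜 1 γ.1 0 0 0 f Ω Z = f Ω Z)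
    {M : OSet n p} (hC : M.1.toBlocks₂₁ = 0) {Ω : Matrix (Fin n) (Fin n) ℂ} (hΩ : Ω ∈ siegelH n)
    (Z : Matrix (Fin m) (Fin n) ℂ) :
    slash ρ 𝓜 (Quotient.out (toLeft M)).mult (Quotient.out (toLeft M)).1 0 0 0 f Ω Z =
      slash ρ 𝓜 M.mult M.1 0 0 0 f Ω Z := by
  have h : toLeft M = toLeft (Quotient.out (toLeft M)) := (Quotient.out_eq (toLeft M)).symm
  obtain ⟨γ, hγ⟩ := exists_of_toLeft_eq h
  rw [← mult_eq_of_toLeft_eq hn h, hγ]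
  exact slash_mul_of_invariant ρ 𝓜 (hf γ) M.isSimilitude hC M.mult_ne_zero hΩ Z

theorem exists_toLeft_eq_isReduced {N p : ℕ} [Fact p.Prime] (L : LeftCoset (N + 1) p) :
    ∃ M : OSet (N + 1) p, toLeft M = L ∧ IsReduced M.1 := by
  induction L using Quotient.inductionOn with
  | h M =>
    obtain ⟨γ, hγ⟩ := M.isSimilitude.exists_isReduced M.mult_ne_zero
    refine ⟨⟨γ.1 * M.1, M.2.choose, M.isSimilitude.symplectic_mul γ⟩, ?_, hγ⟩
    exact (Quotient.sound ⟨γ, rfl⟩ : toLeft M = _).symm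

/-! ### Right multiplication and the image of the Hecke algebra -/

/-- Right multiplication of a similitude by an element of `Γₙ`. -/
def OSet.mulRight {n p : ℕ} (M : OSet n p) (γ : symplecticGroup (Fin n) ℤ) : OSet n p :=
  ⟨M.1 * γ.1, M.2.choose, M.isSimilitude.mul_symplectic γ⟩

/-- Right multiplication of left cosets by an element of `Γₙ`. -/
def LeftCoset.mulRight {n p : ℕ} (γ : symplecticGroup (Fin n) ℤ) :
    LeftCoset n p → LeftCoset n p :=
  Quotient.map (fun M : OSet n p => M.mulRight γ) (by
    rintro M M' ⟨δ, h⟩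
    exact ⟨δ, by simp only [OSet.mulRight, h, Matrix.mul_assoc]⟩)

theorem LeftCoset.mulRight_toLeft {n p : ℕ} (γ : symplecticGroup (Fin n) ℤ) (M : OSet n p) :
    LeftCoset.mulRight γ (toLeft M) = toLeft (M.mulRight γ) := rfl

theorem LeftCoset.mulRight_injective {n p : ℕ} (γ : symplecticGroup (Fin n) ℤ) :
    Function.Injective (LeftCoset.mulRight γ : LeftCoset n p → LeftCoset n p) := by
  refine Function.LeftInverse.injective (g := LeftCoset.mulRight γ⁻¹) fun L => ?_
  induction L using Quotient.inductionOn with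
  | h M =>
    refine congrArg toLeft (Subtype.ext ?_)
    change M.1 * γ.1 * (γ⁻¹).1 = M.1
    rw [Matrix.mul_assoc, ← Submonoid.coe_mul]
    simp

/-- The double coset which contains a given left coset. -/
def LeftCoset.toDouble {n p : ℕ} : LeftCoset n p → DoubleCoset n p :=
  Quotient.map id (by
    rintro M M' ⟨γ, h⟩
    exact ⟨γ, 1, by simpa using h⟩)

theorem mem_cosetsIn {n p : ℕ} {D : DoubleCoset n p} {L : LeftCoset n p} :
    L ∈ cosetsIn D ↔ L.toDouble = D := by
  constructor
  · rintro ⟨M, rfl, rfl⟩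
    rfl
  · rintro rfl
    refine ⟨Quotient.out L, ?_, Quotient.out_eq L⟩
    conv_rhs => rw [← Quotient.out_eq L]
    rfl

theorem LeftCoset.toDouble_mulRight {n p : ℕ} (γ : symplecticGroup (Fin n) ℤ)
    (L : LeftCoset n p) : (LeftCoset.mulRight γ L).toDouble = L.toDouble := by
  induction L using Quotient.inductionOn with
  | h M =>
    have : SiegelJacobi.toDouble M = SiegelJacobi.toDouble (M.mulRight γ) :=
      Quotient.sound ⟨1, γ, by simp [OSet.mulRight]⟩
    exact this.symm

theorem LeftCoset.exists_mulRight {n p : ℕ} {L L' : LeftCoset n p}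
    (h : L.toDouble = L'.toDouble) : ∃ γ, LeftCoset.mulRight γ L = L' := by
  induction L using Quotient.inductionOn with
  | h M =>
    induction L' using Quotient.inductionOn with
    | h M' =>
      obtain ⟨γ, δ, hM⟩ := Quotient.exact h
      have hM' : M'.1 = γ.1 * M.1 * δ.1 := hM
      exact ⟨δ, Quotient.sound ⟨γ, by simp only [hM', OSet.mulRight, Matrix.mul_assoc]⟩⟩

/-- Every left coset lies in exactly one double coset, so its coefficient comes from that one alone.
The image thus consists of functions constant on double cosets. -/
theorem heckeToLeft_apply {n p : ℕ} [Fact p.Prime] (T : HeckeModule n p) (L : LeftCoset n p) :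
    heckeToLeft n p T L = T L.toDouble := by
  classical
  induction T using Finsupp.induction_linear with
  | zero => simp
  | add S T hS hT => simp [hS, hT]
  | single D c =>
    simp [heckeToLeft, Finsupp.single_apply, Set.Finite.mem_toFinset,
      mem_cosetsIn, eq_comm]

/-- The elements of the module of left cosets invariant under right multiplication come from the
Hecke algebra. -/
theorem exists_heckeToLeft_eq {n p : ℕ} [Fact p.Prime] {X : LeftModule n p}
    (hX : ∀ γ L, X (LeftCoset.mulRight γ L) = X L) : ∃ S, heckeToLeft n p S = X := by
  classical
  have hout : ∀ L : LeftCoset n p,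
      X (toLeft (Quotient.out (LeftCoset.toDouble L))) = X L := by
    intro L
    obtain ⟨γ, hγ⟩ := LeftCoset.exists_mulRight
      (L := toLeft (Quotient.out (LeftCoset.toDouble L))) (L' := L)
      (Quotient.out_eq (LeftCoset.toDouble L))
    rw [← hX γ, hγ]
  refine ⟨Finsupp.onFinset (X.support.image LeftCoset.toDouble)
    (fun D => X (toLeft (Quotient.out D))) fun D hD => ?_, ?_⟩
  · exact Finset.mem_image.2 ⟨_, Finsupp.mem_support_iff.2 hD, Quotient.out_eq D⟩
  · ext L
    rw [heckeToLeft_apply, Finsupp.onFinset_apply, hout]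

/-! ### The Zharkovskaya map -/

section Star

variable {N p : ℕ}

/-- `downMat` on elements of `O_{N+1,p}` of parabolic shape. -/
def OSet.down (M : OSet (N + 1) p) (hk : IsKlingen M.1) : OSet N p :=
  ⟨downMat M.1, M.2.choose, hk.isSimilitude_downMat M.isSimilitude⟩

/-- An element of `Γ_{N+1}` relating two matrices of parabolic shape preserves the line of `e`, so
it has that shape itself and `downMat` applies to it. Its entry scaling `d` is a unit of `ℤ`, and
the positivity conditions make it `1`. -/
theorem OSet.toLeft_down_eq [Fact p.Prime] {M M' : OSet (N + 1) p} (hk : IsKlingen M.1)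
    (hk' : IsKlingen M'.1) (hd : 0 < M.1 (Sum.inr 0) (Sum.inr 0))
    (hd' : 0 < M'.1 (Sum.inr 0) (Sum.inr 0)) (h : toLeft M = toLeft M') :
    toLeft (M.down hk) = toLeft (M'.down hk') ∧
      M.1 (Sum.inr 0) (Sum.inr 0) = M'.1 (Sum.inr 0) (Sum.inr 0) := by
  obtain ⟨γ, hγ⟩ := exists_of_toLeft_eq h
  have ha : M.1 (Sum.inl 0) (Sum.inl 0) ≠ 0 := by
    intro h0
    have h1 := (M.isSimilitude.isKlingen M.mult_ne_zero hk.A_col hk.C_col).2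
    rw [h0, mul_zero] at h1
    exact M.mult_ne_zero (by exact_mod_cast h1.symm)
  have hcol : ∀ i, M'.1 i (Sum.inl 0) = γ.1 i (Sum.inl 0) * M.1 (Sum.inl 0) (Sum.inl 0) := by
    intro i
    rw [hγ]
    simp [Matrix.mul_apply, Fintype.sum_sum_type, Fin.sum_univ_succ, hk.A_col, hk.C_col]
  obtain ⟨hkγ, hγ1⟩ := (isSimilitude_of_mem γ).isKlingen one_ne_zero
    (fun i => (mul_eq_zero.1 ((hcol _).symm.trans (hk'.A_col i))).resolve_right ha)
    (fun i => (mul_eq_zero.1 ((hcol _).symm.trans (hk'.C_col i))).resolve_right ha)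
  refine ⟨Quotient.sound ⟨⟨downMat γ.1, ?_⟩, ?_⟩, ?_⟩
  · have := hkγ.isSimilitude_downMat (isSimilitude_of_mem γ)
    rw [SymplecticGroup.mem_iff']
    simpa [IsSimilitude] using this
  · change downMat M'.1 = downMat γ.1 * downMat M.1
    rw [hγ, hkγ.downMat_mul hk]
  · have h2 : M'.1 (Sum.inr 0) (Sum.inr 0) =
        γ.1 (Sum.inr 0) (Sum.inr 0) * M.1 (Sum.inr 0) (Sum.inr 0) := by
      rw [hγ, hkγ.mul_apply_inr]
    have h3 : 0 < γ.1 (Sum.inr 0) (Sum.inr 0) := by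
      rw [h2] at hd'
      exact (mul_pos_iff_of_pos_right hd).1 hd'
    have h4 : γ.1 (Sum.inr 0) (Sum.inr 0) = 1 := by
      rcases Int.eq_one_or_neg_one_of_mul_eq_one (by simpa using hγ1) with h5 | h5
      · exact h5
      · rw [h5] at h3
        norm_num at h3
    rw [h2, h4, one_mul]

theorem starO_eq_down {M : OSet (N + 1) p} (hr : IsReduced M.1) :
    starO M hr = M.down hr.isKlingen := Subtype.ext hr.starMat_eq

/-- Removes the choice from `starCoset`. Allowing every representative of parabolic shape with `d >
0` matters, because right multiplication by `upSp γ` keeps that shape but can destroy `C = 0`. -/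
theorem starCoset_toLeft [Fact p.Prime] (r : ℤ) {M : OSet (N + 1) p} (hk : IsKlingen M.1)
    (hd : 0 < M.1 (Sum.inr 0) (Sum.inr 0)) :
    starCoset r (toLeft M) = Finsupp.single (toLeft (M.down hk))
      (((M.1 (Sum.inr 0) (Sum.inr 0) : ℤ) : ℂ) ^ (-r)) := by
  have h := exists_toLeft_eq_isReduced (toLeft M)
  rw [starCoset, dif_pos h, starO_eq_down]
  obtain ⟨h1, h2⟩ := OSet.toLeft_down_eq h.choose_spec.2.isKlingen hk h.choose_spec.2.d_pos hd
    h.choose_spec.1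
  rw [h1, ← h2]
  rfl

theorem starCoset_mulRight [Fact p.Prime] (r : ℤ) (γ : symplecticGroup (Fin N) ℤ)
    (L : LeftCoset (N + 1) p) :
    starCoset r (LeftCoset.mulRight (upSp γ) L) =
      (starCoset r L).mapDomain (LeftCoset.mulRight γ) := by
  obtain ⟨M, rfl, hr⟩ := exists_toLeft_eq_isReduced L
  have hk : IsKlingen (M.mulRight (upSp γ)).1 := hr.isKlingen.mul (isKlingen_upMat γ.1)
  have hd : (M.mulRight (upSp γ)).1 (Sum.inr 0) (Sum.inr 0) = M.1 (Sum.inr 0) (Sum.inr 0) := by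
    change (M.1 * upMat γ.1) _ _ = _
    rw [hr.isKlingen.mul_apply_inr, upMat_apply_inr, mul_one]
  have hdown : (M.mulRight (upSp γ)).down hk = (M.down hr.isKlingen).mulRight γ := by
    apply Subtype.ext
    change downMat (M.1 * upMat γ.1) = downMat M.1 * γ.1
    rw [hr.isKlingen.downMat_mul (isKlingen_upMat γ.1), downMat_upMat]
  rw [LeftCoset.mulRight_toLeft, starCoset_toLeft r hk (by rw [hd]; exact hr.d_pos),
    starCoset_toLeft r hr.isKlingen hr.d_pos, Finsupp.mapDomain_single,
    LeftCoset.mulRight_toLeft, hd, hdown]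

theorem starLeft_mapDomain [Fact p.Prime] (r : ℤ) (γ : symplecticGroup (Fin N) ℤ)
    (X : LeftModule (N + 1) p) :
    starLeft r (X.mapDomain (LeftCoset.mulRight (upSp γ))) =
      (starLeft r X).mapDomain (LeftCoset.mulRight γ) := by
  induction X using Finsupp.induction_linear with
  | zero => simp
  | add X Y hX hY => rw [Finsupp.mapDomain_add, map_add, hX, hY, map_add, Finsupp.mapDomain_add]
  | single L c =>
    simp [starLeft, starCoset_mulRight, Finsupp.mapDomain_smul]

/-- Right multiplication by `Γₙ` permutes the left cosets inside each double coset. -/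
theorem mapDomain_mulRight_heckeToLeft {n : ℕ} [Fact p.Prime] (γ : symplecticGroup (Fin n) ℤ)
    (T : HeckeModule n p) :
    (heckeToLeft n p T).mapDomain (LeftCoset.mulRight γ) = heckeToLeft n p T := by
  ext L
  obtain ⟨L', rfl⟩ : ∃ L', LeftCoset.mulRight γ L' = L := by
    refine ⟨LeftCoset.mulRight γ⁻¹ L, ?_⟩
    induction L using Quotient.inductionOn with
    | h M =>
      refine congrArg toLeft (Subtype.ext ?_)
      change M.1 * (γ⁻¹).1 * γ.1 = M.1
      rw [Matrix.mul_assoc, ← Submonoid.coe_mul]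
      simp
  rw [Finsupp.mapDomain_apply (LeftCoset.mulRight_injective γ), heckeToLeft_apply,
    heckeToLeft_apply, LeftCoset.toDouble_mulRight]

/-- The element `T*` exists. -/
theorem exists_isZharkovskaya [Fact p.Prime] (r : ℤ) (T : HeckeModule (N + 1) p) :
    ∃ S : HeckeModule N p, IsZharkovskaya r T S := by
  refine exists_heckeToLeft_eq fun γ L => ?_
  -- Invariance of `j(T)` under the embedded `Γ_N` passes through the equivariant star map to
  -- invariance of `j(T)*` under `Γ_N`.
  conv_lhs => rw [← mapDomain_mulRight_heckeToLeft (upSp γ) T, starLeft_mapDomain]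
  exact Finsupp.mapDomain_apply (LeftCoset.mulRight_injective γ) _ _

end Star

/-! ### Linearity of the action of left cosets -/

theorem slashLeft_apply {n m p : ℕ} {V : Type*} [AddCommGroup V] [Module ℂ V]
    (ρ : Representation ℂ (GeneralLinearGroup (Fin n) ℂ) V) (𝓜 : Matrix (Fin m) (Fin m) ℝ)
    (f : Matrix (Fin n) (Fin n) ℂ → Matrix (Fin m) (Fin n) ℂ → V) (X : LeftModule n p)
    (Ω : Matrix (Fin n) (Fin n) ℂ) (Z : Matrix (Fin m) (Fin n) ℂ) :
    slashLeft ρ 𝓜 f X Ω Z = Finsupp.linearCombination ℂ (fun L : LeftCoset n p =>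
      slash ρ 𝓜 (Quotient.out L).mult (Quotient.out L).1 0 0 0 f Ω Z) X := by
  simp [slashLeft, Finsupp.sum, Finsupp.linearCombination_apply, Finset.sum_apply]

theorem linearCombination_starLeft {N p : ℕ} {W : Type*} [AddCommGroup W] [Module ℂ W] (r : ℤ)
    (w : LeftCoset N p → W) (X : LeftModule (N + 1) p) :
    Finsupp.linearCombination ℂ w (starLeft r X) =
      Finsupp.linearCombination ℂ
        (fun L => Finsupp.linearCombination ℂ w (starCoset r L)) X := by
  induction X using Finsupp.induction_linear with
  | zero => simp
  | add X Y hX hY => rw [map_add, map_add, map_add, hX, hY]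
  | single L c => simp [starLeft]

/-- The theorem for a single left coset. The representatives chosen by `Quotient.out` need not be
reduced; invariance of `f` and of `R ∘ Ψ⁰ f` allows replacing them by `M` and `M*`. -/
theorem IsJacobiForm.exists_tendsto_siegelPath_out {N m p : ℕ} (hN : 1 ≤ N) [Fact p.Prime]
    {V V₀ : Type*} [NormedAddCommGroup V] [NormedSpace ℂ V] [FiniteDimensional ℂ V]
    [NormedAddCommGroup V₀] [NormedSpace ℂ V₀] {𝓜 : Matrix (Fin m) (Fin m) ℝ}
    {ρ : Representation ℂ (GeneralLinearGroup (Fin (N + 1)) ℂ) V} (hρ : IsRationalRep ρ)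
    {ρ₀ : Representation ℂ (GeneralLinearGroup (Fin N) ℂ) V₀} {R : V →ₗ[ℂ] V₀} {k : ℤ}
    (h1 : ∀ A : GeneralLinearGroup (Fin N) ℂ, R ∘ₗ ρ (diagGL 1 A) = ρ₀ A ∘ₗ R)
    (h2 : ∀ a : ℂˣ, R ∘ₗ ρ (diagGL a 1) = ((a : ℂ) ^ k) • R)
    {f : Matrix (Fin (N + 1)) (Fin (N + 1)) ℂ → Matrix (Fin m) (Fin (N + 1)) ℂ → V}
    (hf : IsJacobiForm ρ 𝓜 ⊤ f) {G : Matrix (Fin N) (Fin N) ℂ → Matrix (Fin m) (Fin N) ℂ → V}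
    (hG : ∀ X ∈ siegelH (N + 1), ∀ Z : Matrix (Fin m) (Fin (N + 1)) ℂ,
      Tendsto (fun t : ℝ => f (X + Matrix.single 0 0 (Complex.I * t)) Z) atTop
        (𝓝 (G (X.submatrix Fin.succ Fin.succ) (Z.submatrix id Fin.succ))))
    (L : LeftCoset (N + 1) p) {Ω : Matrix (Fin N) (Fin N) ℂ} (hΩ : Ω ∈ siegelH N)
    (Z : Matrix (Fin m) (Fin N) ℂ) :
    ∃ v : V,
      Tendsto (siegelPath (slash ρ 𝓜 (Quotient.out L).mult (Quotient.out L).1 0 0 0 f) Ω Z) atTop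
        (𝓝 v) ∧
      R v = Finsupp.linearCombination ℂ (fun L' : LeftCoset N p =>
        slash ρ₀ 𝓜 (Quotient.out L').mult (Quotient.out L').1 0 0 0
          (fun Ω' Z' => R (siegelJacobi f Ω' Z')) Ω Z) (starCoset k L) := by
  obtain ⟨M, rfl, hr⟩ := exists_toLeft_eq_isReduced L
  have hlim : ∀ Ω ∈ siegelH N, ∀ Z : Matrix (Fin m) (Fin N) ℂ, siegelJacobi f Ω Z = G Ω Z :=
    fun Ω hΩ Z => (tendsto_siegelPath hG hΩ Z).limUnder_eq
  have hlim' : ∀ Ω ∈ siegelH N, ∀ Z : Matrix (Fin m) (Fin N) ℂ,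
      Tendsto (siegelPath f Ω Z) atTop (𝓝 (siegelJacobi f Ω Z)) := fun Ω hΩ Z => by
    rw [hlim Ω hΩ Z]
    exact tendsto_siegelPath hG hΩ Z
  have hstar : IsSimilitude M.mult (starMat M.1) := isSimilitude_starMat hr M.isSimilitude
  have hΩ' := hstar.smul_mem_siegelH starMat_toBlocks₂₁ M.mult_ne_zero hΩ
  -- Degree `N ≥ 1` is what makes the multiplier chosen for `M*` agree with that of `M`.
  have hmult : (starO M hr).mult = M.mult := (starO M hr).isSimilitude.unique hN hstar
  refine ⟨_, (hr.tendsto_siegelPath_slash ρ 𝓜 M.isSimilitude M.mult_ne_zero hG hΩ Z).congr' ?_, ?_⟩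
  · filter_upwards [eventually_gt_atTop 0] with t ht
    exact (slash_out_toLeft (Nat.succ_pos N) ρ 𝓜
      (fun γ Ω hΩ Z => hf.invariant γ trivial 0 0 0 (by simp [Matrix.IsSymm]) Ω hΩ Z) hr.C_eq
      (diagBlock_mem_siegelH hΩ ht) _).symm
  · rw [hr.intertwiner_repInv M.isSimilitude M.mult_ne_zero h1 h2
      (fun x s => hρ.apply_lowerUniGL (hf.apply_lowerUniGL_of_int hG hΩ' _) x s),
      starCoset_toLeft k hr.isKlingen hr.d_pos, Finsupp.linearCombination_single,
      ← starO_eq_down hr,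
      slash_out_toLeft hN ρ₀ 𝓜
        (fun γ Ω hΩ Z => hf.slash_intertwiner_siegelJacobi hlim' h1 γ hΩ Z)
        (M := starO M hr) starMat_toBlocks₂₁ hΩ Z, hmult,
      slash_of_blkC_eq_zero ρ₀ 𝓜 M.mult (g := (starO M hr).1) (blkC_eq_zero starMat_toBlocks₂₁)]
    change _ = _ • repInv ρ₀ (blkD (starMat M.1)) (R (siegelJacobi f
      ((blkA (starMat M.1) * Ω + blkB (starMat M.1)) * (blkD (starMat M.1))⁻¹) _))
    rw [hlim _ hΩ']
    rfl

end SiegelJacobi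
end

open SiegelJacobi in
/-- The degree is `n = N + 1 ≥ 2`. The element `S` is `T*`; the two `Tendsto` parts say that the
limits which define both sides exist. -/
theorem theorem9p4 {N m p : ℕ} (hN : 1 ≤ N) (hm : 1 ≤ m) [Fact p.Prime]
    {V V₀ : Type*} [NormedAddCommGroup V] [NormedSpace ℂ V] [FiniteDimensional ℂ V]
    [NormedAddCommGroup V₀] [NormedSpace ℂ V₀] [FiniteDimensional ℂ V₀]
    (𝓜 : Matrix (Fin m) (Fin m) ℝ) (h𝓜 : 𝓜.PosSemidef) (h𝓜' : HalfIntegral 𝓜)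
    (ρ : Representation ℂ (Matrix.GeneralLinearGroup (Fin (N + 1)) ℂ) V) (hρ : IsRationalRep ρ)
    (ρ₀ : Representation ℂ (Matrix.GeneralLinearGroup (Fin N) ℂ) V₀) (hρ₀ : IsRationalRep ρ₀)
    (R : V →ₗ[ℂ] V₀) (k : ℤ)
    (h1 : ∀ A : Matrix.GeneralLinearGroup (Fin N) ℂ, R ∘ₗ ρ (diagGL 1 A) = ρ₀ A ∘ₗ R)
    (h2 : ∀ a : ℂˣ, R ∘ₗ ρ (diagGL a 1) = ((a : ℂ) ^ k) • R)
    (f : Matrix (Fin (N + 1)) (Fin (N + 1)) ℂ → Matrix (Fin m) (Fin (N + 1)) ℂ → V)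
    (hf : IsJacobiForm ρ 𝓜 ⊤ f) (T : HeckeModule (N + 1) p) :
    ∃ S : HeckeModule N p, IsZharkovskaya k T S ∧
      ∀ Ω ∈ siegelH N, ∀ Z : Matrix (Fin m) (Fin N) ℂ,
        Filter.Tendsto (siegelPath f Ω Z) Filter.atTop (nhds (siegelJacobi f Ω Z)) ∧
        Filter.Tendsto (siegelPath (slashHecke ρ 𝓜 f T) Ω Z) Filter.atTop
          (nhds (siegelJacobi (slashHecke ρ 𝓜 f T) Ω Z)) ∧
        R (siegelJacobi (slashHecke ρ 𝓜 f T) Ω Z) =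
          slashHecke ρ₀ 𝓜 (fun Ω' Z' => R (siegelJacobi f Ω' Z')) S Ω Z := by
  obtain ⟨S, hS⟩ := exists_isZharkovskaya k T
  obtain ⟨G, hG⟩ := hf.exists_tendsto
  refine ⟨S, hS, fun Ω hΩ Z => ?_⟩
  -- `j(T)` is a finite combination of left cosets, so limits and `R` pass through the sum and the
  -- cosets can be treated one at a time.
  choose v hv hRv using fun L : LeftCoset (N + 1) p =>
    hf.exists_tendsto_siegelPath_out hN hρ h1 h2 hG L hΩ Z
  have hlim : Filter.Tendsto (siegelPath (slashHecke ρ 𝓜 f T) Ω Z) Filter.atTop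
      (nhds (Finsupp.linearCombination ℂ v (heckeToLeft (N + 1) p T))) := by
    rw [Finsupp.linearCombination_apply]
    refine (tendsto_finsetSum _ fun L _ =>
      (hv L).const_smul (heckeToLeft (N + 1) p T L)).congr fun t => ?_
    rw [siegelPath, slashHecke, slashLeft_apply, Finsupp.linearCombination_apply]
    rfl
  refine ⟨?_, ?_, ?_⟩
  · have := tendsto_siegelPath hG hΩ Z
    rwa [siegelJacobi, this.limUnder_eq]
  · rwa [siegelJacobi, hlim.limUnder_eq]
  · rw [siegelJacobi, hlim.limUnder_eq, slashHecke, slashLeft_apply, hS,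
      linearCombination_starLeft, Finsupp.apply_linearCombination]
    congr 1
    congr 1
    funext L
    exact hRv L
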